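/- Let $\Gamma\subset\mathbb R^m\times\mathbb R$ be a lattice of full rank such that both coordinate projections $p_1:\mathbb R^m\times\mathbb R\to\mathbb R^m$ and $p_2:\mathbb R^m\times\mathbb R\to\mathbb R$ are injective on $\Gamma$ and have dense image $p_1(\Gamma)\subset\mathbb R^m$, $p_2(\Gamma)\subset\mathbb R$. Let $\Gamma^*=\{\eta:\gamma\cdot\eta\in\mathbb Z\text{ for all }\gamma\in\Gamma\}$ be the dual lattice, and let $p_1^*,p_2^*$ be the coordinate projections of $\mathbb R^m\times\mathbb R$ regarded on $\Gamma^*$. Let $\Omega\subset\mathbb R$ be a nonempty compact interval which is the closure of its interior, symmetric around the origin, and such that $\partial\Omega\cap p_2(\Gamma)=\emptyset$. Let $\Lambda(\Omega)=\{p_1(\gamma):\gamma\in\Gamma,\ p_2(\gamma)\in\Omega\}$ be the corresponding simple generic model set, with density $$D(\Lambda(\Omega))=\lim_{R\to\infty}R^{-m}\,\#\bigl(\Lambda(\Omega)\cap(x+R[0,1]^m)\bigr),$$ where the limit exists for every $x\in\mathbb R^m$ and does not depend on $x$. Fix $0<\epsilon<1$, put $\Omega_n=(1-\epsilon^n)\Omega$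 and $\operatorname{sinc}(t)=\frac{\sin \pi t}{\pi t}$ (with $\operatorname{sinc}(0)=1$), and let $\Psi$ be the uniform limit on $\mathbb R$, which exists, of the functions $$\widehat\psi_n(t)=\prod_{s=0}^\infty\operatorname{sinc}\bigl(t\,|\epsilon^{ns}\Omega_n|\bigr)\qquad(n\to\infty).$$ Put $\Phi=|\Omega|\cdot(\Psi*\Psi)$. Let $\mathcal K$ be a countable index set, and let $g_k,h_k\in W(L^2,\ell^1)$ for $k\in\mathcal K$, i.e. $\sum_{j\in\mathbb Z^m}\|g_k\mathbb 1_{j+[0,1]^m}\|_2<\infty$, and likewise for $h_k$. Write $T_\lambda f(t)=f(t-\lambda)$ and $\widehat f(\omega)=\int_{\mathbb R^m}f(t)e^{-2\pi i t\cdot\omega}\,dt$, and let $\langle\cdot,\cdot\rangle$ be the inner product of $L^2(\mathbb R^m)$, linear in the first argument. Assume that $\{T_\lambda g_k:k\in\mathcal K,\lambda\in\Lambda(\Omega)\}$ and $\{T_\lambda h_k:k\in\mathcal K,\lambda\in\Lambda(\Omega)\}$ are Bessel sequences in $L^2(\mathbb R^m)$, with upper frame bounds $B_g$ and $B_h$,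 respectively, i.e. $\sum_{k\in\mathcal K}\sum_{\lambda\in\Lambda(\Omega)}|\langle f,T_\lambda g_k\rangle|^2\le B_g\|f\|_2^2$ for all $f\in L^2(\mathbb R^m)$, and likewise for $h_k$ and $B_h$. Then $$\sum_{k\in\mathcal K}\sum_{\lambda\in\Lambda(\Omega)}\langle f,T_\lambda g_k\rangle\langle T_\lambda h_k,f\rangle=\|f\|_2^2\qquad\text{for all }f\in L^2(\mathbb R^m)$$ (with absolute convergence) if and only if, for each $\eta\in\Gamma^*$, $$D(\Lambda(\Omega))\,\Phi(-p_2^*(\eta))\sum_{k\in\mathcal K}\overline{\widehat g_k(t)}\,\widehat h_k(t-p_1^*(\eta))=\delta_{\eta,0}\qquad\text{for a.e. }t\in\mathbb R^m,$$ where $\delta$ is the Kronecker delta. -/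

import Mathlib

open MeasureTheory Filter Topology
open scoped FourierTransform ENNReal Pointwise InnerProductSpace ComplexConjugate

/-- The physical space `ℝ^m` with its Euclidean structure. -/
abbrev Phys (m : ℕ) : Type := EuclideanSpace ℝ (Fin m)

/-- The cube `x + R [0,1]^m`. -/
def cube {m : ℕ} (x : Phys m) (R : ℝ) : Set (Phys m) :=
  {y | ∀ i, x i ≤ y i ∧ y i ≤ x i + R}

/-! ### Function spaces and systems of translates -/

/-- Membership in the Wiener amalgam space `W(L^p, ℓ¹)`: the sum over `k ∈ ℤ^m` of the `L^p` norms
of `f` restricted to the unit cubes `k + [0,1]^m` is finite. -/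
def MemWienerAmalgam {m : ℕ} (f : Phys m → ℂ) (p : ℝ≥0∞) : Prop :=
  AEStronglyMeasurable f volume ∧
    ∑' k : Fin m → ℤ,
      eLpNorm ((cube (WithLp.toLp 2 fun i => (k i : ℝ)) 1).indicator f) p volume < ∞

/-- Translation `T_a f (t) = f (t - a)`. -/
def translateBy {m : ℕ} (a : Phys m) (f : Phys m → ℂ) : Phys m → ℂ :=
  fun t => f (t - a)

/-- The inner product of `L²(ℝ^m)`, linear in the first argument. -/
noncomputable def l2Inner {m : ℕ} (f g : Phys m → ℂ) : ℂ :=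
  ∫ t, f t * conj (g t)

/-- `{T_a g_k : k ∈ K, a ∈ Λ}` is a Bessel sequence in `L²(ℝ^m)` with upper frame bound `B`. -/
def IsBesselSystem {m : ℕ} {K : Type*} (g : K → Phys m → ℂ) (Λ : Set (Phys m)) (B : ℝ) : Prop :=
  0 < B ∧ ∀ f : Phys m → ℂ, MemLp f 2 volume →
    ∑' k : K, ∑' a : Λ, ‖l2Inner f (translateBy (a : Phys m) (g k))‖ₑ ^ 2
      ≤ ENNReal.ofReal B * eLpNorm f 2 volume ^ 2

/-! ### Lattices and model sets -/

/-- The conditions on the projections of the lattice `Γ ⊂ ℝ^m × ℝ`: both coordinate projections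
are injective on `Γ` and have dense image. -/
structure IsCutAndProject {m : ℕ} (Γ : Submodule ℤ (Phys m × ℝ)) : Prop where
  injOn_fst : Set.InjOn Prod.fst (Γ : Set (Phys m × ℝ))
  dense_fst : Dense (Prod.fst '' (Γ : Set (Phys m × ℝ)))
  injOn_snd : Set.InjOn Prod.snd (Γ : Set (Phys m × ℝ))
  dense_snd : Dense (Prod.snd '' (Γ : Set (Phys m × ℝ)))

/-- The dual lattice, with respect to the inner product of the orthogonal sum `ℝ^m ⊕ ℝ`. -/
def dualLattice {m : ℕ} (Γ : Submodule ℤ (Phys m × ℝ)) : Set (Phys m × ℝ) :=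
  {η | ∀ γ ∈ Γ, ∃ n : ℤ, ⟪γ.1, η.1⟫_ℝ + γ.2 * η.2 = n}

/-- A window of a simple model set: a nonempty compact interval of `ℝ` which is the closure of its
interior and has a boundary of measure zero. -/
structure IsSimpleWindow (Ω : Set ℝ) : Prop where
  nonempty : Ω.Nonempty
  isCompact : IsCompact Ω
  closure_interior : closure (interior Ω) = Ω
  volume_frontier : volume (frontier Ω) = 0
  ordConnected : Ω.OrdConnected

/-- The model set `Λ(Ω)` of the lattice `Γ` and the window `Ω`. -/
def modelSet {m : ℕ} (Γ : Submodule ℤ (Phys m × ℝ)) (Ω : Set ℝ) : Set (Phys m) :=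
  {a | ∃ γ ∈ Γ, γ.2 ∈ Ω ∧ γ.1 = a}

/-- The model set is generic: the boundary of the window does not meet the projection of `Γ`. -/
def IsGeneric {m : ℕ} (Γ : Submodule ℤ (Phys m × ℝ)) (Ω : Set ℝ) : Prop :=
  Disjoint (frontier Ω) (Prod.snd '' (Γ : Set (Phys m × ℝ)))

/-- `D` is the density of `Λ`: the number of points in `x + R [0,1]^m`, divided by `R^m`, tends
to `D` as `R → ∞`, for every `x`. -/
def HasDensity {m : ℕ} (Λ : Set (Phys m)) (D : ℝ) : Prop :=
  ∀ x : Phys m,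
    Tendsto (fun R : ℝ => ((Λ ∩ cube x R).ncard : ℝ) / R ^ m) atTop (𝓝 D)

/-! ### The function `Φ` -/

/-- The Fourier transform `∏_{s ≥ 0} sinc (t |ε^{ns} Ω_n|)`, with `Ω_n = (1 - ε^n) Ω` and
`sinc t = sin (π t) / (π t)`, of the infinite convolution product of the normalized indicator
functions of the sets `ε^{ns} Ω_n`, `s ≥ 0`. -/
noncomputable def psiHat (Ω : Set ℝ) (ε : ℝ) (n : ℕ) (t : ℝ) : ℝ :=
  ∏' s : ℕ, Real.sinc (Real.pi * (t * volume.real (ε ^ (n * s) • ((1 - ε ^ n) • Ω))))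

/-- `Φ = |Ω| (Ψ * Ψ)`, where `Ψ` stands for the uniform limit of the functions `psiHat Ω ε n`. -/
noncomputable def windowPhi (Ω : Set ℝ) (Ψ : ℝ → ℝ) (x : ℝ) : ℝ :=
  volume.real Ω * convolution Ψ Ψ (ContinuousLinearMap.mul ℝ ℝ) volume x

/-!
The argument is a Fourier expansion on the torus `(ℝ^m × ℝ) / Γ`.

A symmetric window is an interval `[-r, r]`. The product `psiHat` has first factor close to
`sinc (2 r t)` and its other factors tend to `1`, so `Ψ t = sinc (2 r t)`
(`tendstoUniformly_psiHat`), where `sinc t = sin (π t) / (π t)`. Its inverse Fourier transform is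
the normalized indicator function of the window, whence `Φ t = sinc (2 r t)` as well
(`windowPhi_Icc`). The density of the model set is `2 r / covol Γ` (`hasDensity_modelSet`).

For square integrable `f` let `p x = ∑ₖ ⟨f, T_x g_k⟩ conj ⟨f, T_x h_k⟩` (`corrProd`). The
`Γ`-periodization of `p x · 1_[-r, r] y` (`stripPeriodization`) has at `(x, 0)` the value of the
frame sum of the translate of `f` by `-x`. The Bessel inequality for the translates of `f`, with
the density of the second coordinates of `Γ`, makes `p` integrable
(`lintegral_lt_top_of_stripSum_le`), and unfolding gives the Fourier coefficient of the
periodization at `η ∈ Γ*` (`setIntegral_stripPeriodization`): up to the covolume it is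
`2 r · sinc (2 r η₂) · p̂(η₁)`. The reproducing identity for all translates of `f` says that the
periodization equals `‖f‖²` on `ℝ^m × {0}`. Since it is continuous in `y` at generic points and
`p₂(Γ)` is dense, this is the same as being constant almost everywhere, that is, to having the
Fourier coefficients of a constant (`fourier_of_stripPeriodization_eq_const`,
`ae_stripPeriodization_eq_const_of_fourier`); genericity makes `y = 0` a point of continuity.

By Parseval, `p̂(ξ) = ∫ f̂(t) conj f̂(t - ξ) H_ξ(t) dt`, where
`H_ξ(t) = ∑ₖ conj ĝ_k(t) ĥ_k(t - ξ)` (`fourier_corrProd`). As `f̂` runs through all of `L²`,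
polarization turns the conditions on these quadratic forms into almost everywhere identities for
`H_ξ` (`ae_eq_zero_of_quadratic`). What is obtained for almost every translate of `f` holds for `f`
itself because the frame sum depends continuously on `f` in `L²`
(`IsBesselSystem.continuous_stripPeriodization`).
-/

/-! ### The Fourier transform on `L¹ ∩ L²` -/

section FourierLTwo

variable {V : Type*} [NormedAddCommGroup V] [InnerProductSpace ℝ V] [FiniteDimensional ℝ V]
  [MeasurableSpace V] [BorelSpace V]

theorem continuous_fourier_of_integrable {F : V → ℂ} (hF : Integrable F) : Continuous (𝓕 F) :=
  VectorFourier.fourierIntegral_continuous Real.continuous_fourierChar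
    (innerSL ℝ).continuous₂ hF

/-- On `L¹ ∩ L²` the Fourier transform defined by extension from Schwartz functions agrees with
the Fourier integral: both represent the same tempered distribution. -/
theorem coeFn_fourier_toLp {F : V → ℂ} (h1 : Integrable F) (h2 : MemLp F 2) :
    ((𝓕 (h2.toLp F) : Lp ℂ 2 (volume : Measure V)) : V → ℂ) =ᵐ[volume] 𝓕 F := by
  refine ae_eq_of_integral_contDiff_smul_eq ?_
    (continuous_fourier_of_integrable h1).locallyIntegrable ?_
  · exact (Lp.memLp _).locallyIntegrable (by norm_num)
  intro φ hφ hφs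
  have hφ' : ContDiff ℝ ((⊤ : ℕ∞) : WithTop ℕ∞) (fun x => (φ x : ℂ)) := Complex.ofRealCLM.contDiff.comp hφ
  have hφs' : HasCompactSupport (fun x => (φ x : ℂ)) := hφs.comp_left Complex.ofReal_zero
  let S : SchwartzMap V ℂ := hφs'.toSchwartzMap hφ'
  have hS : ∀ x, S x = (φ x : ℂ) := fun x => rfl
  have e1 := congrArg (fun T => T S) (Lp.fourier_toTemperedDistribution_eq (h2.toLp F))
  simp only [TemperedDistribution.fourier_apply, Lp.toTemperedDistribution_apply] at e1
  have e2 : ∫ x, φ x • ((𝓕 (h2.toLp F) : Lp ℂ 2 (volume : Measure V)) : V → ℂ) x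
      = ∫ x, (𝓕 S) x * F x := by
    calc _ = ∫ x, S x • ((𝓕 (h2.toLp F) : Lp ℂ 2 (volume : Measure V)) : V → ℂ) x := by
            refine integral_congr_ae (Eventually.of_forall fun x => ?_)
            simp [hS]
      _ = _ := e1.symm
      _ = _ := by
            refine integral_congr_ae ?_
            filter_upwards [h2.coeFn_toLp] with x hx
            rw [hx, smul_eq_mul]
  rw [e2]
  have e3 := VectorFourier.integral_bilin_fourierIntegral_eq_flip (ContinuousLinearMap.mul ℂ ℂ)
    (L := innerₗ V) (μ := volume) (ν := volume) Real.continuous_fourierChar continuous_inner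
    S.integrable h1
  simp only [ContinuousLinearMap.mul_apply', flip_innerₗ] at e3
  have e4 : ∫ x, (𝓕 S) x * F x = ∫ x, S x * 𝓕 F x := e3
  rw [e4]
  refine integral_congr_ae (Eventually.of_forall fun x => ?_)
  simp [hS]

theorem memLp_two_fourier {F : V → ℂ} (h1 : Integrable F) (h2 : MemLp F 2) :
    MemLp (𝓕 F) 2 :=
  (Lp.memLp (𝓕 (h2.toLp F) : Lp ℂ 2 (volume : Measure V))).ae_eq (coeFn_fourier_toLp h1 h2)

/-- Parseval's identity, one factor in `L²` and the other in `L¹ ∩ L²`. -/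
theorem integral_fourier_mul_conj_fourier {f G : V → ℂ} (hf : MemLp f 2)
    (h1 : Integrable G) (h2 : MemLp G 2) :
    ∫ t, ((𝓕 (hf.toLp f) : Lp ℂ 2 (volume : Measure V)) : V → ℂ) t * conj (𝓕 G t)
      = ∫ t, f t * conj (G t) := by
  have e := Lp.inner_fourier_eq (h2.toLp G) (hf.toLp f)
  rw [L2.inner_def, L2.inner_def] at e
  calc _ = _ := ?_
    _ = _ := e
    _ = _ := ?_
  · refine integral_congr_ae ?_
    filter_upwards [coeFn_fourier_toLp h1 h2] with t ht
    rw [RCLike.inner_apply, ht]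
  · refine integral_congr_ae ?_
    filter_upwards [h2.coeFn_toLp, hf.coeFn_toLp] with t ht ht'
    rw [RCLike.inner_apply, ht, ht']

/-- Parseval's identity for the Fourier integral on `L¹ ∩ L²`. -/
theorem integral_fourier_mul_conj {F G : V → ℂ} (hF1 : Integrable F) (hF2 : MemLp F 2)
    (hG1 : Integrable G) (hG2 : MemLp G 2) :
    ∫ t, 𝓕 F t * conj (𝓕 G t) = ∫ t, F t * conj (G t) := by
  rw [← integral_fourier_mul_conj_fourier hF2 hG1 hG2]
  refine integral_congr_ae ?_
  filter_upwards [coeFn_fourier_toLp hF1 hF2] with t ht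
  rw [ht]

theorem integral_fourierInv_mul_conj {F G : V → ℂ} (hF1 : Integrable F) (hF2 : MemLp F 2)
    (hG1 : Integrable G) (hG2 : MemLp G 2) :
    ∫ t, 𝓕⁻ F t * conj (𝓕⁻ G t) = ∫ t, F t * conj (G t) := by
  rw [← integral_fourier_mul_conj hF1 hF2 hG1 hG2,
    ← integral_neg_eq_self (fun t => 𝓕 F t * conj (𝓕 G t))]
  simp only [Real.fourierInv_eq_fourier_neg]

theorem memLp_two_fourierInv {F : V → ℂ} (h1 : Integrable F) (h2 : MemLp F 2) :
    MemLp (𝓕⁻ F) 2 := by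
  have : 𝓕⁻ F = 𝓕 F ∘ fun x => -x := by
    ext x; exact Real.fourierInv_eq_fourier_neg F x
  rw [this]
  exact (memLp_two_fourier h1 h2).comp_measurePreserving (Measure.measurePreserving_neg volume)

theorem norm_fourier_le_integral {F : V → ℂ} (t : V) : ‖𝓕 F t‖ ≤ ∫ v, ‖F v‖ :=
  VectorFourier.norm_fourierIntegral_le_integral_norm _ _ _ _ _

theorem fourier_comp_sub_right (F : V → ℂ) (a t : V) :
    𝓕 (fun x => F (x - a)) t = Complex.exp ((-(2 * Real.pi * ⟪a, t⟫_ℝ) : ℝ) * Complex.I) * 𝓕 F t := by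
  have := congrFun (VectorFourier.fourierIntegral_comp_add_right Real.fourierChar
    (volume : Measure V) (innerₗ V) F (-a)) t
  rw [Circle.smul_def, Real.fourierChar_apply] at this
  simp only [map_neg, LinearMap.neg_apply, innerₗ_apply_apply, smul_eq_mul] at this
  refine Eq.trans ?_ (this.trans ?_)
  · change VectorFourier.fourierIntegral _ _ _ _ _ = _
    simp only [sub_eq_add_neg]
    rfl
  · congr 2
    push_cast; ring

/-- Modulation on the physical side is translation on the Fourier side. -/
theorem fourierInv_comp_sub_right (F : V → ℂ) (a x : V) :
    𝓕⁻ (fun t => F (t - a)) x = Complex.exp ((2 * Real.pi * ⟪x, a⟫_ℝ : ℝ) * Complex.I) * 𝓕⁻ F x := by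
  rw [Real.fourierInv_eq_fourier_neg, fourier_comp_sub_right, Real.fourierInv_eq_fourier_neg,
    inner_neg_right, real_inner_comm]
  congr 2
  push_cast; ring

/-- Correlations of an `L²` function with the translates of a function in `L¹ ∩ L²` are the
inverse Fourier integral of `f̂ · conj ĝ`. -/
theorem integral_mul_conj_translate {f G : V → ℂ} (hf : MemLp f 2)
    (h1 : Integrable G) (h2 : MemLp G 2) (x : V) :
    ∫ t, f t * conj (G (t - x)) =
      𝓕⁻ (fun t => ((𝓕 (hf.toLp f) : Lp ℂ 2 (volume : Measure V)) : V → ℂ) t * conj (𝓕 G t)) x := by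
  have h1' : Integrable (fun t => G (t - x)) := h1.comp_sub_right x
  have h2' : MemLp (fun t => G (t - x)) 2 :=
    h2.comp_measurePreserving (measurePreserving_sub_right volume x)
  rw [← integral_fourier_mul_conj_fourier hf h1' h2', Real.fourierInv_eq']
  refine integral_congr_ae (Eventually.of_forall fun t => ?_)
  simp only
  rw [fourier_comp_sub_right, map_mul, ← Complex.exp_conj, smul_eq_mul, map_mul, Complex.conj_I,
    Complex.conj_ofReal, real_inner_comm t x]
  have : ((-(2 * Real.pi * ⟪t, x⟫_ℝ) : ℝ) : ℂ) * -Complex.I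
      = ((2 * Real.pi * ⟪t, x⟫_ℝ : ℝ) : ℂ) * Complex.I := by push_cast; ring
  rw [this]; ring

end FourierLTwo

/-! ### The window and the functions `Ψ` and `Φ` -/

theorem exists_eq_Icc_of_isSimpleWindow {Ω : Set ℝ} (hΩ : IsSimpleWindow Ω) (hsymm : -Ω = Ω) :
    ∃ r : ℝ, 0 < r ∧ Ω = Set.Icc (-r) r := by
  have h1 := eq_Icc_of_connected_compact ⟨hΩ.nonempty, hΩ.ordConnected.isPreconnected⟩ hΩ.isCompact
  have h2 : sInf Ω = -sSup Ω := by
    conv_lhs => rw [← hsymm]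
    exact Real.sInf_neg Ω
  rw [h2] at h1
  refine ⟨sSup Ω, ?_, h1⟩
  have h3 : (interior Ω).Nonempty := by
    rw [← closure_nonempty_iff, hΩ.closure_interior]; exact hΩ.nonempty
  obtain ⟨x, hx⟩ := h3
  rw [h1, interior_Icc] at hx
  linarith [hx.1, hx.2]

theorem abs_sinc_sub_one_le (v : ℝ) : |Real.sinc v - 1| ≤ 2 * v ^ 2 := by
  have key : ∀ v : ℝ, 0 < v → |Real.sinc v - 1| ≤ 2 * v ^ 2 := by
    intro v hv
    rcases le_or_gt v 1 with h | h
    · have h1 := Real.sin_gt_sub_cube hv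
      rw [abs_sub_comm, abs_of_nonneg (by linarith [Real.sinc_le_one v]),
        Real.sinc_of_ne_zero hv.ne', sub_le_iff_le_add, ← sub_le_iff_le_add', le_div_iff₀ hv]
      nlinarith [pow_pos hv 3]
    · have h1 := Real.sinc_le_one v
      have h2 := Real.neg_one_le_sinc v
      rw [abs_le]
      constructor <;> nlinarith
  rcases lt_trichotomy v 0 with h | h | h
  · simpa using key (-v) (by linarith)
  · simp [h]
  · exact key v h

theorem abs_sinc_le_inv (v : ℝ) (hv : v ≠ 0) : |Real.sinc v| ≤ |v|⁻¹ := by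
  rw [Real.sinc_of_ne_zero hv, abs_div, div_eq_mul_inv]
  exact mul_le_of_le_one_left (by positivity) (Real.abs_sin_le_one v)

theorem abs_prod_sub_one_le_sum_of_abs_le_one (y : ℕ → ℝ) (hy : ∀ s, |y s| ≤ 1) (N : ℕ) :
    |∏ s ∈ Finset.range N, y s - 1| ≤ ∑ s ∈ Finset.range N, |y s - 1| := by
  induction N with
  | zero => simp
  | succ N ih =>
    rw [Finset.prod_range_succ, Finset.sum_range_succ]
    calc |(∏ s ∈ Finset.range N, y s) * y N - 1|
        = |(∏ s ∈ Finset.range N, y s - 1) * y N + (y N - 1)| := by ring_nf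
      _ ≤ |(∏ s ∈ Finset.range N, y s - 1) * y N| + |y N - 1| := abs_add_le _ _
      _ ≤ _ := by
        rw [abs_mul]
        gcongr
        exact (mul_le_of_le_one_right (abs_nonneg _) (hy N)).trans ih

theorem psiHat_Icc {r : ℝ} (hr : 0 < r) {ε : ℝ} (hε0 : 0 < ε) (hε1 : ε < 1) (n : ℕ) (t : ℝ) :
    psiHat (Set.Icc (-r) r) ε n t =
      ∏' s : ℕ, Real.sinc (Real.pi * (2 * r) * t * (1 - ε ^ n) * (ε ^ n) ^ s) := by
  unfold psiHat
  refine tprod_congr fun s => ?_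
  congr 1
  have h1 : (0 : ℝ) ≤ 1 - ε ^ n := by
    have := pow_le_one₀ hε0.le hε1.le (n := n); linarith
  rw [measureReal_def, Measure.addHaar_smul, Measure.addHaar_smul, Real.volume_Icc]
  simp only [Module.finrank_self, pow_one, ENNReal.toReal_mul]
  rw [ENNReal.toReal_ofReal (abs_nonneg _), ENNReal.toReal_ofReal (abs_nonneg _),
    ENNReal.toReal_ofReal (by linarith), abs_of_nonneg h1, abs_of_nonneg (by positivity), pow_mul]
  ring

theorem multipliable_sinc_geometric (u : ℝ) {q : ℝ} (hq0 : 0 ≤ q) (hq1 : q < 1) :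
    Multipliable fun s : ℕ => Real.sinc (u * q ^ s) := by
  have hs : Summable fun s : ℕ => ‖Real.sinc (u * q ^ s) - 1‖ := by
    refine Summable.of_nonneg_of_le (fun _ => norm_nonneg _)
      (fun s => (abs_sinc_sub_one_le _).trans_eq ?_)
      ((summable_geometric_of_lt_one (sq_nonneg q) (by nlinarith)).mul_left (2 * u ^ 2))
    rw [mul_pow, ← pow_mul, ← pow_mul, mul_comm s 2]; ring
  have := multipliable_one_add_of_summable hs
  simpa using this

/-- The product differs from its factor `s = 0` by little when the ratio `q` is small. -/
theorem abs_tprod_sinc_sub_le (u : ℝ) {q : ℝ} (hq0 : 0 ≤ q) (hq1 : q ≤ 1 / 2) :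
    |∏' s : ℕ, Real.sinc (u * q ^ s) - Real.sinc u| ≤ |Real.sinc u| * (4 * u ^ 2 * q) := by
  have hm := (multipliable_sinc_geometric u hq0 (by linarith : q < 1)).hasProd.tendsto_prod_nat
  have hm' := ((tendsto_add_atTop_iff_nat 1).2 hm).sub_const (Real.sinc u) |>.abs
  refine le_of_tendsto hm' (Eventually.of_forall fun N => ?_)
  rw [Finset.prod_range_succ']
  simp only [pow_zero, mul_one]
  rw [← sub_one_mul, abs_mul, mul_comm]
  refine mul_le_mul_of_nonneg_left ?_ (abs_nonneg _)
  refine (abs_prod_sub_one_le_sum_of_abs_le_one _ (fun s => Real.abs_sinc_le_one _) N).trans ?_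
  have hq2 : q ^ 2 < 1 := by nlinarith
  calc ∑ s ∈ Finset.range N, |Real.sinc (u * q ^ (s + 1)) - 1|
      ≤ ∑ s ∈ Finset.range N, 2 * u ^ 2 * q ^ 2 * (q ^ 2) ^ s := by
        refine Finset.sum_le_sum fun s _ => (abs_sinc_sub_one_le _).trans_eq ?_
        rw [mul_pow, ← pow_mul, ← pow_mul]; ring
    _ ≤ 2 * u ^ 2 * q ^ 2 * (1 - q ^ 2)⁻¹ := by
        rw [← Finset.mul_sum]
        gcongr
        rw [← tsum_geometric_of_lt_one (sq_nonneg q) hq2]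
        exact (summable_geometric_of_lt_one (sq_nonneg q) hq2).sum_le_tsum _
          (fun _ _ => by positivity)
    _ ≤ 4 * u ^ 2 * q := by
        rw [← div_eq_mul_inv, div_le_iff₀ (by linarith)]
        have h0 : 0 ≤ u ^ 2 * q := by positivity
        have h1 : 2 * q ≤ 4 * (1 - q ^ 2) := by nlinarith
        linarith [mul_le_mul_of_nonneg_left h1 h0]

/-- The infinite products converge uniformly to their first factor in the limit: on bounded sets
the other factors tend to `1`, and far out everything is small. -/
theorem tendstoUniformly_psiHat {r : ℝ} (hr : 0 < r) {ε : ℝ} (hε0 : 0 < ε) (hε1 : ε < 1) :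
    TendstoUniformly (psiHat (Set.Icc (-r) r) ε) (fun t => Real.sinc (Real.pi * (2 * r) * t))
      atTop := by
  have hpow : Tendsto (fun n : ℕ => ε ^ n) atTop (𝓝 0) :=
    tendsto_pow_atTop_nhds_zero_of_lt_one hε0.le hε1
  rw [Metric.tendstoUniformly_iff]
  intro δ hδ
  -- for `|u| > U` the two functions are at most `2 / |u|` and `1 / |u|`, and `3 / U < δ`
  set U : ℝ := 6 / δ + 1 with hU
  have hU0 : 0 < U := by positivity
  have huc : UniformContinuousOn Real.sinc (Set.Icc (-U) U) :=
    isCompact_Icc.uniformContinuousOn_of_continuous Real.continuous_sinc.continuousOn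
  rw [Metric.uniformContinuousOn_iff] at huc
  obtain ⟨κ, hκ, hκ'⟩ := huc (δ / 2) (by positivity)
  have e1 : ∀ᶠ n : ℕ in atTop, ε ^ n < 1 / 2 := hpow.eventually_lt_const (by norm_num)
  have e2 : ∀ᶠ n : ℕ in atTop, ε ^ n < κ / U := hpow.eventually_lt_const (by positivity)
  have e3 : ∀ᶠ n : ℕ in atTop, ε ^ n < δ / 2 / (4 * U ^ 2) :=
    hpow.eventually_lt_const (by positivity)
  filter_upwards [e1, e2, e3] with n h1 h2 h3 t
  rw [psiHat_Icc hr hε0 hε1, dist_comm, Real.dist_eq]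
  set q := ε ^ n with hq
  have hq0 : 0 < q := by positivity
  set u := Real.pi * (2 * r) * t with hu
  set w := u * (1 - q) with hw
  have hP := abs_tprod_sinc_sub_le w hq0.le h1.le
  rcases le_or_gt |u| U with hle | hgt
  · have hwu : |w| ≤ |u| := by
      rw [hw, abs_mul, abs_of_pos (by linarith : 0 < 1 - q)]
      exact mul_le_of_le_one_right (abs_nonneg _) (by linarith)
    have a1 : |Real.sinc w - Real.sinc u| < δ / 2 := by
      rw [← Real.dist_eq]
      refine hκ' w (abs_le.1 (hwu.trans hle)) u (abs_le.1 hle) ?_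
      rw [Real.dist_eq, hw, show u * (1 - q) - u = -(u * q) by ring, abs_neg, abs_mul,
        abs_of_pos hq0]
      calc |u| * q ≤ U * q := by gcongr
        _ < U * (κ / U) := by gcongr
        _ = κ := by field_simp
    have a2 : |Real.sinc w| * (4 * w ^ 2 * q) ≤ δ / 2 := by
      calc |Real.sinc w| * (4 * w ^ 2 * q) ≤ 1 * (4 * U ^ 2 * (δ / 2 / (4 * U ^ 2))) := by
            refine mul_le_mul (Real.abs_sinc_le_one _) ?_ (by positivity) (by norm_num)
            refine mul_le_mul ?_ h3.le hq0.le (by positivity)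
            have : w ^ 2 ≤ U ^ 2 := by
              rw [← sq_abs w]; exact pow_le_pow_left₀ (abs_nonneg _) (hwu.trans hle) 2
            linarith
        _ = δ / 2 := by field_simp
    calc _ ≤ |∏' s : ℕ, Real.sinc (w * q ^ s) - Real.sinc w| + |Real.sinc w - Real.sinc u| :=
          abs_sub_le _ _ _
      _ < δ := by linarith
  · have hu0 : u ≠ 0 := by
      intro h; rw [h, abs_zero] at hgt; linarith
    have hw2 : |u| / 2 ≤ |w| := by
      rw [hw, abs_mul u, abs_of_pos (by linarith : 0 < 1 - q)]
      nlinarith [abs_nonneg u]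
    have hw0 : w ≠ 0 := by
      intro h; rw [h, abs_zero] at hw2; linarith
    have hprod : |∏' s : ℕ, Real.sinc (w * q ^ s)| ≤ |Real.sinc w| := by
      have hm := (multipliable_sinc_geometric w hq0.le
        (by linarith : q < 1)).hasProd.tendsto_prod_nat
      have hm' := ((tendsto_add_atTop_iff_nat 1).2 hm).abs
      refine le_of_tendsto hm' (Eventually.of_forall fun N => ?_)
      rw [Finset.prod_range_succ']
      simp only [pow_zero, mul_one]
      rw [abs_mul, Finset.abs_prod]
      exact mul_le_of_le_one_left (abs_nonneg _)
        (Finset.prod_le_one (fun _ _ => abs_nonneg _) fun _ _ => Real.abs_sinc_le_one _)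
    have b1 : |Real.sinc w| ≤ 2 * |u|⁻¹ := by
      refine (abs_sinc_le_inv w hw0).trans ?_
      calc |w|⁻¹ ≤ (|u| / 2)⁻¹ := by
            refine inv_anti₀ (by positivity) hw2
        _ = _ := by rw [inv_div, div_eq_mul_inv]
    have b2 := abs_sinc_le_inv u hu0
    have b3 : |u|⁻¹ ≤ U⁻¹ := inv_anti₀ hU0 hgt.le
    have b4 : 3 * U⁻¹ < δ := by
      rw [← div_eq_mul_inv, div_lt_iff₀ hU0, hU, mul_add, mul_div_cancel₀ _ hδ.ne']
      linarith
    calc _ ≤ |∏' s : ℕ, Real.sinc (w * q ^ s)| + |Real.sinc u| := abs_sub _ _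
      _ < δ := by linarith

/-- The Fourier transform of the window `[-r, r]`. -/
theorem fourier_indicator_Icc {r : ℝ} (hr : 0 < r) (t : ℝ) :
    𝓕 ((Set.Icc (-r) r).indicator (fun _ => (1 : ℂ))) t
      = ((2 * r * Real.sinc (Real.pi * (2 * r) * t) : ℝ) : ℂ) := by
  rw [Real.fourier_real_eq_integral_exp_smul]
  have e1 : (fun v : ℝ => Complex.exp (↑(-2 * Real.pi * v * t) * Complex.I) •
      (Set.Icc (-r) r).indicator (fun _ => (1 : ℂ)) v)
      = (Set.Icc (-r) r).indicator
        (fun v : ℝ => Complex.exp ((-2 * Real.pi * t * Complex.I : ℂ) * v)) := by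
    ext v
    by_cases hv : v ∈ Set.Icc (-r) r
    · simp only [hv, Set.indicator_of_mem, smul_eq_mul, mul_one]
      congr 1; push_cast; ring
    · simp [hv]
  rw [e1, integral_indicator measurableSet_Icc, integral_Icc_eq_integral_Ioc,
    ← intervalIntegral.integral_of_le (by linarith)]
  by_cases ht : t = 0
  · subst ht
    simp
    ring
  · have hc : (-2 * Real.pi * t * Complex.I : ℂ) ≠ 0 := by
      simp [Real.pi_ne_zero, ht, Complex.I_ne_zero]
    rw [integral_exp_mul_complex hc, Real.sinc_of_ne_zero (by positivity)]
    have hs := Complex.two_sin (Real.pi * (2 * r) * t)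
    push_cast
    rw [div_eq_iff hc]
    have hp : (Real.pi : ℂ) ≠ 0 := by exact_mod_cast Real.pi_ne_zero
    have hr' : (r : ℂ) ≠ 0 := by exact_mod_cast hr.ne'
    have ht' : (t : ℂ) ≠ 0 := by exact_mod_cast ht
    have e2 : (2 * r * (Complex.sin (Real.pi * (2 * r) * t) / (Real.pi * (2 * r) * t)) *
        (-2 * Real.pi * t * Complex.I) : ℂ)
        = - (2 * Complex.sin (Real.pi * (2 * r) * t)) * Complex.I := by
      field_simp
    rw [e2, hs]
    have e3 : (-2 * Real.pi * t * Complex.I * r : ℂ) = -(Real.pi * (2 * r) * t) * Complex.I := by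
      ring
    have e4 : (-2 * Real.pi * t * Complex.I * -r : ℂ) = (Real.pi * (2 * r) * t) * Complex.I := by
      ring
    rw [e3, e4]
    linear_combination (Complex.exp (-(Real.pi * (2 * r) * t) * Complex.I)
      - Complex.exp ((Real.pi * (2 * r) * t) * Complex.I)) * Complex.I_mul_I

theorem integrable_indicator_Icc (r : ℝ) :
    Integrable ((Set.Icc (-r) r).indicator (fun _ => (1 : ℂ))) := by
  rw [integrable_indicator_iff measurableSet_Icc]
  exact continuousOn_const.integrableOn_Icc

theorem memLp_indicator_Icc (r : ℝ) (p : ℝ≥0∞) :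
    MemLp ((Set.Icc (-r) r).indicator (fun _ => (1 : ℂ))) p :=
  memLp_indicator_const p measurableSet_Icc 1 (Or.inr (by simp))

/-- `sinc` reproduces itself under convolution, because its Fourier transform is the indicator
function of an interval. -/
theorem windowPhi_Icc {r : ℝ} (hr : 0 < r) (x : ℝ) :
    windowPhi (Set.Icc (-r) r) (fun t => Real.sinc (Real.pi * (2 * r) * t)) x
      = Real.sinc (Real.pi * (2 * r) * x) := by
  set F : ℝ → ℂ := (Set.Icc (-r) r).indicator (fun _ => (1 : ℂ)) with hF
  have hF1 : Integrable F := integrable_indicator_Icc r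
  have hF2 : MemLp F 2 := memLp_indicator_Icc r 2
  set e : ℝ → ℂ := fun v => Complex.exp ((2 * Real.pi * (x * v) : ℝ) * Complex.I) with he
  have hec : Continuous e := by fun_prop
  have hen : ∀ v, ‖e v‖ = 1 := fun v => Complex.norm_exp_ofReal_mul_I _
  -- modulation by `x` shifts the Fourier transform, so Parseval for `F` and `G` is the convolution
  -- of `𝓕 F` with itself at `x`, and the other side is `𝓕 F x` since `F * F = F`
  set G : ℝ → ℂ := fun v => e v * F v with hG
  have hG1 : Integrable G := by
    refine hF1.mono (hec.aestronglyMeasurable.mul hF1.1) (Eventually.of_forall fun v => ?_)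
    simp [hG, hen]
  have hG2 : MemLp G 2 := by
    refine hF2.mono (hec.aestronglyMeasurable.mul hF1.1) (Eventually.of_forall fun v => ?_)
    simp [hG, hen]
  have hGF : ∀ s, 𝓕 G s = 𝓕 F (s - x) := by
    intro s
    rw [Real.fourier_real_eq_integral_exp_smul, Real.fourier_real_eq_integral_exp_smul]
    refine integral_congr_ae (Eventually.of_forall fun v => ?_)
    simp only [hG, he, smul_eq_mul]
    rw [← mul_assoc, ← Complex.exp_add]
    congr 2; push_cast; ring
  have hP := integral_fourier_mul_conj hF1 hF2 hG1 hG2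
  have hR : ∫ t, F t * conj (G t) = 𝓕 F x := by
    rw [Real.fourier_real_eq_integral_exp_smul]
    refine integral_congr_ae (Eventually.of_forall fun v => ?_)
    simp only [hG, he, smul_eq_mul, map_mul, ← Complex.exp_conj, Complex.conj_I,
      Complex.conj_ofReal]
    have h1 : conj (F v) = F v ∧ F v * F v = F v := by
      by_cases hv : v ∈ Set.Icc (-r) r <;> simp [hF, hv]
    rw [h1.1, mul_left_comm, h1.2]
    congr 2; push_cast; ring
  have hL : ∫ t, 𝓕 F t * conj (𝓕 G t) = (((2 * r) ^ 2 * ∫ s, Real.sinc (Real.pi * (2 * r) * s) *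
      Real.sinc (Real.pi * (2 * r) * (x - s)) : ℝ) : ℂ) := by
    rw [← integral_const_mul, ← integral_complex_ofReal]
    refine integral_congr_ae (Eventually.of_forall fun s => ?_)
    simp only
    rw [hGF, hF, fourier_indicator_Icc hr, fourier_indicator_Icc hr, Complex.conj_ofReal,
      ← Complex.ofReal_mul, ← Real.sinc_neg (Real.pi * (2 * r) * (s - x))]
    congr 1
    rw [show -(Real.pi * (2 * r) * (s - x)) = Real.pi * (2 * r) * (x - s) by ring]
    ring
  rw [hR, hL, hF, fourier_indicator_Icc hr, Complex.ofReal_inj] at hP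
  unfold windowPhi convolution
  simp only [ContinuousLinearMap.mul_apply']
  rw [Real.volume_real_Icc_of_le (by linarith)]
  have h2 : (2 * r) ≠ 0 := by positivity
  refine mul_left_cancel₀ h2 ?_
  rw [← hP]; ring

/-! ### Uniqueness of Fourier coefficients on a torus -/

section TorusUniqueness

-- the normalization of the measure on the circle for which Mathlib states `mFourierBasis`
noncomputable local instance : MeasureSpace UnitAddCircle := ⟨AddCircle.haarAddCircle⟩

local instance : IsProbabilityMeasure (volume : Measure UnitAddCircle) :=
  inferInstanceAs (IsProbabilityMeasure AddCircle.haarAddCircle)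

variable {ι : Type*} [Fintype ι]

theorem ae_eq_zero_of_mFourierCoeff_eq_zero {G : UnitAddTorus ι → ℂ}
    (hG : MemLp G 2) (h : ∀ n, UnitAddTorus.mFourierCoeff G n = 0) : G =ᵐ[volume] 0 := by
  have h2 : UnitAddTorus.mFourierBasis.repr (hG.toLp G) = 0 := by
    ext n
    rw [UnitAddTorus.mFourierBasis_repr, lp.coeFn_zero, Pi.zero_apply, ← h n]
    refine integral_congr_ae ?_
    filter_upwards [hG.coeFn_toLp] with t ht
    rw [ht]
  have h3 : hG.toLp G = 0 := by
    rwa [LinearIsometryEquiv.map_eq_zero_iff] at h2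
  have h4 := hG.coeFn_toLp
  rw [h3] at h4
  exact h4.symm.trans (Lp.coeFn_zero _ _ _)

/-- The same in coordinates, for a bounded `ℤ^ι`-periodic function on `ℝ^ι`. -/
theorem ae_eq_zero_of_unitBox_fourier {F : (ι → ℝ) → ℂ} (hF : Measurable F) {C : ℝ}
    (hC : ∀ x, ‖F x‖ ≤ C) (hper : ∀ (n : ι → ℤ) x, F (fun i => x i + n i) = F x)
    (h : ∀ n : ι → ℤ, ∫ x in {x : ι → ℝ | ∀ i, x i ∈ Set.Ioc (0 : ℝ) (0 + 1)},
      Complex.exp ((-(2 * Real.pi * ∑ i, n i * x i) : ℝ) * Complex.I) * F x = 0) :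
    ∀ᵐ x ∂volume.restrict {x : ι → ℝ | ∀ i, x i ∈ Set.Ioc (0 : ℝ) (0 + 1)}, F x = 0 := by
  let s : UnitAddTorus ι → (ι → ℝ) := fun θ i => (AddCircle.equivIoc (1 : ℝ) 0 (θ i) : ℝ)
  have hs : Measurable s := by
    refine measurable_pi_lambda _ fun i => ?_
    exact measurable_subtype_coe.comp
      ((AddCircle.measurableEquivIoc (1 : ℝ) 0).measurable.comp (measurable_pi_apply i))
  let G : UnitAddTorus ι → ℂ := F ∘ s
  have hGF : ∀ x : ι → ℝ, G (fun i => (x i : UnitAddCircle)) = F x := by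
    intro x
    have : ∀ i, ∃ n : ℤ, s (fun i => (x i : UnitAddCircle)) i = x i + n := by
      intro i
      have h1 : ((s (fun i => (x i : UnitAddCircle)) i : ℝ) : UnitAddCircle) = (x i : ℝ) :=
        AddCircle.coe_equivIoc (p := (1 : ℝ)) (a := 0)
      rw [← sub_eq_zero, ← AddCircle.coe_sub, AddCircle.coe_eq_zero_iff] at h1
      obtain ⟨n, hn⟩ := h1
      refine ⟨n, ?_⟩
      rw [zsmul_one] at hn
      linarith
    choose n hn using this
    have e : s (fun i => (x i : UnitAddCircle)) = fun i => x i + n i := funext hn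
    simp only [G, Function.comp_apply, e, hper]
  have hG2 : MemLp G 2 := by
    refine MemLp.of_bound (hF.comp hs).aestronglyMeasurable C (Eventually.of_forall fun θ => hC _)
  have hz := ae_eq_zero_of_mFourierCoeff_eq_zero hG2 (fun n => by
    rw [UnitAddTorus.mFourierCoeff_eq_integral G n 0, ← h n]
    refine integral_congr_ae (Eventually.of_forall fun x => ?_)
    simp only [hGF, smul_eq_mul]
    congr 1
    simp only [UnitAddTorus.mFourier, ContinuousMap.coe_mk, fourier_coe_apply, Pi.neg_apply]
    rw [← Complex.exp_sum]
    congr 1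
    push_cast
    rw [Finset.mul_sum, ← Finset.sum_neg_distrib, Finset.sum_mul]
    refine Finset.sum_congr rfl fun i _ => ?_
    simp; ring)
  have hl := UnitAddTorus.lintegral_preimage (fun θ => ‖G θ‖ₑ) (0 : ι → ℝ)
  have hl0 : ∫⁻ θ : UnitAddTorus ι, ‖G θ‖ₑ = 0 := by
    rw [lintegral_eq_zero_iff' hG2.1.enorm]
    filter_upwards [hz] with θ hθ
    simp [hθ]
  rw [hl0] at hl
  simp only [hGF] at hl
  have := (lintegral_eq_zero_iff hF.enorm).1 hl.symm
  filter_upwards [this] with x hx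
  simpa using hx

end TorusUniqueness

/-! ### Measure-theoretic instances for lattices

Mathlib's action of a `ℤ`-submodule by translations is that of its underlying additive subgroup. -/

section LatticeInstances

variable {E : Type*} [NormedAddCommGroup E] [MeasurableSpace E] [BorelSpace E]
  [SecondCountableTopology E]

instance instMeasurableVAddSubmoduleInt (L : Submodule ℤ E) : MeasurableVAdd L E :=
  inferInstanceAs (MeasurableVAdd L.toAddSubgroup E)

instance instVAddInvariantMeasureSubmoduleInt (L : Submodule ℤ E) (μ : Measure E)
    [μ.IsAddLeftInvariant] : VAddInvariantMeasure L E μ :=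
  inferInstanceAs (VAddInvariantMeasure L.toAddSubgroup E μ)

instance instIsAddHaarMeasureVolumeProd (m : ℕ) :
    (volume : Measure (Phys m × ℝ)).IsAddHaarMeasure :=
  inferInstanceAs
    ((volume : Measure (Phys m)).prod (volume : Measure ℝ)).IsAddHaarMeasure

end LatticeInstances

/-! ### Uniqueness of Fourier coefficients on a lattice quotient -/

section LatticeUniqueness

variable {E : Type*} [NormedAddCommGroup E] [NormedSpace ℝ E] [FiniteDimensional ℝ E]
  [MeasurableSpace E] [BorelSpace E] {μ : Measure E} [μ.IsAddHaarMeasure]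

/-- A bounded function on a finite-dimensional space which is periodic with respect to a lattice
and whose Fourier coefficients over a fundamental domain all vanish is zero almost everywhere.
In coordinates given by a lattice basis this is completeness of the characters of a torus. -/
theorem ae_eq_zero_of_lattice_fourier {L : Submodule ℤ E} [DiscreteTopology L] [IsZLattice ℝ L]
    {F : E → ℂ} (hF : Measurable F) {C : ℝ} (hC : ∀ x, ‖F x‖ ≤ C)
    (hper : ∀ γ ∈ L, ∀ x, F (x + γ) = F x) {D : Set E} (hD : IsAddFundamentalDomain L D μ)
    (h : ∀ χ : E →ₗ[ℝ] ℝ, (∀ γ ∈ L, ∃ n : ℤ, χ γ = n) →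
      ∫ z in D, Complex.exp ((-(2 * Real.pi * χ z) : ℝ) * Complex.I) * F z ∂μ = 0) :
    F =ᵐ[μ] 0 := by
  classical
  set bz := Module.Free.chooseBasis ℤ L with hbz
  set b := bz.ofZLatticeBasis ℝ L with hb
  have hD0 : IsAddFundamentalDomain L (ZSpan.fundamentalDomain b) μ :=
    ZLattice.isAddFundamentalDomain bz μ
  have hbL : ∀ i, b i ∈ L := fun i => by rw [hb, bz.ofZLatticeBasis_apply ℝ L]; exact (bz i).2
  have hrepr : ∀ γ ∈ L, ∀ i, ∃ n : ℤ, b.repr γ i = n := fun γ hγ i =>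
    ⟨bz.repr ⟨γ, hγ⟩ i, bz.ofZLatticeBasis_repr_apply ℝ L ⟨γ, hγ⟩ i⟩
  let Φ : E ≃L[ℝ] (Module.Free.ChooseBasisIndex ℤ L → ℝ) := b.equivFunL
  have hΦ : ∀ z i, Φ z i = b.repr z i := fun z i => rfl
  let ν : Measure (Module.Free.ChooseBasisIndex ℤ L → ℝ) := μ.map Φ
  have : ν.IsAddHaarMeasure := Φ.isAddHaarMeasure_map μ
  -- the Lebesgue measure is a multiple of the transported measure
  have hν : (volume : Measure (Module.Free.ChooseBasisIndex ℤ L → ℝ)) =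
      Measure.addHaarScalarFactor volume ν • ν := Measure.isAddLeftInvariant_eq_smul _ _
  have hν' : ν = Measure.addHaarScalarFactor ν volume •
      (volume : Measure (Module.Free.ChooseBasisIndex ℤ L → ℝ)) :=
    Measure.isAddLeftInvariant_eq_smul _ _
  set box : Set (Module.Free.ChooseBasisIndex ℤ L → ℝ) :=
    {x | ∀ i, x i ∈ Set.Ioc (0 : ℝ) (0 + 1)} with hbox
  have hboxm : MeasurableSet box := MeasurableSet.univ_pi' fun i => measurableSet_Ioc
  have hbox' : box =ᵐ[volume] {x | ∀ i, x i ∈ Set.Ico (0 : ℝ) 1} := by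
    have e1 : box = Set.pi Set.univ fun i => Set.Ioc (0 : ℝ) 1 := by
      ext x; simp [hbox]
    have e2 : {x : Module.Free.ChooseBasisIndex ℤ L → ℝ | ∀ i, x i ∈ Set.Ico (0 : ℝ) 1}
        = Set.pi Set.univ fun i => Set.Ico (0 : ℝ) 1 := by
      ext x; simp
    rw [e1, e2]
    exact (Measure.univ_pi_Ioc_ae_eq_Icc (μ := fun _ => volume)).trans
      (Measure.univ_pi_Ico_ae_eq_Icc (μ := fun _ => volume)).symm
  have hboxν : box =ᵐ[ν] {x | ∀ i, x i ∈ Set.Ico (0 : ℝ) 1} := by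
    rw [hν']; exact (Measure.absolutelyContinuous_of_le_smul le_rfl).ae_eq hbox'
  have hpre : Φ ⁻¹' {x | ∀ i, x i ∈ Set.Ico (0 : ℝ) 1} = ZSpan.fundamentalDomain b := rfl
  have hpreae : (Φ ⁻¹' box : Set E) =ᵐ[μ] ZSpan.fundamentalDomain b := by
    rw [← hpre]
    exact (Φ.continuous.measurable.measurePreserving μ).quasiMeasurePreserving.preimage_ae_eq hboxν
  have hF' : Measurable (fun x => F (Φ.symm x)) := hF.comp Φ.symm.continuous.measurable
  have key := ae_eq_zero_of_unitBox_fourier (F := fun x => F (Φ.symm x)) hF' (fun x => hC _)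
    (by
      intro n x
      have e : Φ.symm (fun i => x i + n i) = Φ.symm x + ∑ i, n i • b i := by
        rw [ContinuousLinearEquiv.symm_apply_eq]
        ext i
        rw [hΦ]
        simp [map_add, Finsupp.single_apply, ← hΦ]
      rw [e]
      exact hper _ (Submodule.sum_mem _ fun i _ => L.smul_mem _ (hbL i)) _)
    (by
      intro n
      let χ : E →ₗ[ℝ] ℝ := ∑ i, (n i : ℝ) • b.coord i
      have hχ : ∀ z, χ z = ∑ i, n i * b.repr z i := by
        intro z; simp [χ]
      have hχL : ∀ γ ∈ L, ∃ k : ℤ, χ γ = k := by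
        intro γ hγ
        choose k hk using hrepr γ hγ
        refine ⟨∑ i, n i * k i, ?_⟩
        rw [hχ]; push_cast
        exact Finset.sum_congr rfl fun i _ => by rw [hk]
      have h1 := h χ hχL
      rw [hD.setIntegral_eq hD0 (by
        rintro ⟨γ, hγ⟩ z
        obtain ⟨k, hk⟩ := hχL γ hγ
        change Complex.exp ((-(2 * Real.pi * χ (γ + z)) : ℝ) * Complex.I) * F (γ + z) = _
        rw [add_comm γ z, hper γ hγ, map_add, hk]
        congr 1
        rw [Complex.exp_eq_exp_iff_exists_int]
        refine ⟨-k, ?_⟩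
        push_cast; ring)] at h1
      rw [← setIntegral_congr_set hpreae] at h1
      have h2 : ∫ z in Φ ⁻¹' box, Complex.exp ((-(2 * Real.pi * χ z) : ℝ) * Complex.I) * F z ∂μ
          = ∫ x in box, Complex.exp ((-(2 * Real.pi * ∑ i, n i * x i) : ℝ) * Complex.I) *
            F (Φ.symm x) ∂ν := by
        have := Φ.toHomeomorph.measurableEmbedding.setIntegral_map (μ := μ)
          (fun x => Complex.exp ((-(2 * Real.pi * ∑ i, n i * x i) : ℝ) * Complex.I) *
            F (Φ.symm x)) box
        refine Eq.trans ?_ this.symm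
        refine integral_congr_ae (Eventually.of_forall fun z => ?_)
        simp only [hχ]
        simp [hΦ]
      rw [h2] at h1
      rw [hν, Measure.restrict_smul, integral_smul_nnreal_measure, h1, smul_zero])
  -- back to the whole space by invariance
  have hz : ∀ᵐ x ∂volume, x ∈ box → F (Φ.symm x) = 0 := (ae_restrict_iff' hboxm).1 key
  have hz' : ∀ᵐ x ∂ν, x ∈ box → F (Φ.symm x) = 0 := by
    rw [hν']; exact (Measure.absolutelyContinuous_of_le_smul le_rfl).ae_le hz
  have hz2 : ∀ᵐ z ∂μ, Φ z ∈ box → F (Φ.symm (Φ z)) = 0 :=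
    (Φ.continuous.measurable.measurePreserving μ).quasiMeasurePreserving.ae hz'
  have hz3 : ∀ᵐ z ∂μ, z ∈ ZSpan.fundamentalDomain b → F z = 0 := by
    filter_upwards [hz2, hpreae.mem_iff] with z h1 h2 h3
    simpa using h1 (h2.2 h3)
  have := hD0.measure_zero_of_invariant {z | F z ≠ 0} (by
    rintro ⟨γ, hγ⟩
    ext z
    rw [Set.mem_vadd_set_iff_neg_vadd_mem]
    change F (-γ + z) ≠ 0 ↔ F z ≠ 0
    rw [add_comm, hper _ (L.neg_mem hγ)]) (by
    rw [measure_eq_zero_iff_ae_notMem]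
    filter_upwards [hz3] with z hz hz'
    exact hz'.1 (hz hz'.2))
  exact this

end LatticeUniqueness

/-! ### Sums over the lattice points in a strip -/

section Strip

variable {m : ℕ} {Γ : Submodule ℤ (Phys m × ℝ)}

/-- The sum of `u (γ₁ + x)` over the lattice points `γ` with second coordinate `γ₂` in `J`. -/
noncomputable def stripSum (Γ : Submodule ℤ (Phys m × ℝ)) (J : Set ℝ) (u : Phys m → ℝ≥0∞)
    (x : Phys m) : ℝ≥0∞ :=
  ∑' γ : Γ, J.indicator (fun _ => u ((γ : Phys m × ℝ).1 + x)) (γ : Phys m × ℝ).2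

theorem stripSum_mono {J J' : Set ℝ} (h : J ⊆ J') (u : Phys m → ℝ≥0∞) (x : Phys m) :
    stripSum Γ J u x ≤ stripSum Γ J' u x :=
  ENNReal.tsum_le_tsum fun _ => Set.indicator_le_indicator_of_subset h (fun _ => zero_le) _

theorem stripSum_translate (J : Set ℝ) (u : Phys m → ℝ≥0∞) (x : Phys m) (γ₀ : Γ) :
    stripSum Γ {y | y - (γ₀ : Phys m × ℝ).2 ∈ J} u x =
      stripSum Γ J u ((γ₀ : Phys m × ℝ).1 + x) := by
  unfold stripSum
  rw [← (Equiv.addRight γ₀).tsum_eq]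
  refine tsum_congr fun γ => ?_
  simp only [Equiv.coe_addRight, Submodule.coe_add, Prod.fst_add, Prod.snd_add]
  rw [add_assoc]
  by_cases h : (γ : Phys m × ℝ).2 ∈ J <;> simp [Set.indicator, h]

/-- Control of the sums over one window controls the sums over every bounded window, since the
latter is covered by finitely many translates of the former by elements of the dense group of
second coordinates. -/
theorem exists_stripSum_le (hΓ : Dense (Prod.snd '' (Γ : Set (Phys m × ℝ)))) {r : ℝ} (hr : 0 < r)
    (L : ℝ) : ∃ N : ℕ, ∀ (u : Phys m → ℝ≥0∞) (C : ℝ≥0∞),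
      (∀ x, stripSum Γ (Set.Icc (-r) r) u x ≤ C) →
        ∀ x, stripSum Γ (Set.Icc (-L) L) u x ≤ N * C := by
  have hcov : Set.Icc (-L) L ⊆
      ⋃ γ : Γ, {y : ℝ | dist y (γ : Phys m × ℝ).2 < r} := by
    intro y _
    obtain ⟨_, ⟨γ, hγ, rfl⟩, hd⟩ := hΓ.exists_dist_lt y hr
    exact Set.mem_iUnion.2 ⟨⟨γ, hγ⟩, hd⟩
  obtain ⟨t, ht⟩ := isCompact_Icc.elim_finite_subcover _
    (fun γ : Γ => isOpen_lt (by fun_prop) continuous_const) hcov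
  refine ⟨t.card, fun u C hC x => ?_⟩
  calc stripSum Γ (Set.Icc (-L) L) u x
      ≤ ∑ γ₀ ∈ t, stripSum Γ {y | y - (γ₀ : Phys m × ℝ).2 ∈ Set.Icc (-r) r} u x := by
        unfold stripSum
        rw [← Summable.tsum_finsetSum fun _ _ => ENNReal.summable]
        refine ENNReal.tsum_le_tsum fun γ => ?_
        by_cases h : (γ : Phys m × ℝ).2 ∈ Set.Icc (-L) L
        · obtain ⟨γ₀, hγ₀, hd⟩ := Set.mem_iUnion₂.1 (ht h)
          have hmem : (γ : Phys m × ℝ).2 ∈ {y | y - (γ₀ : Phys m × ℝ).2 ∈ Set.Icc (-r) r} := by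
            have hd' : |(γ : Phys m × ℝ).2 - (γ₀ : Phys m × ℝ).2| < r := hd
            exact abs_le.1 hd'.le
          rw [Set.indicator_of_mem h]
          refine le_trans ?_ (Finset.single_le_sum (fun _ _ => zero_le) hγ₀)
          rw [Set.indicator_of_mem hmem]
        · rw [Set.indicator_of_notMem h]; exact zero_le
    _ ≤ ∑ _γ₀ ∈ t, C := Finset.sum_le_sum fun γ₀ _ => by
        rw [stripSum_translate]; exact hC _
    _ = t.card * C := by simp

/-- The bound is uniform over all translates of the window. -/
theorem exists_stripSum_shift_le (hΓ : Dense (Prod.snd '' (Γ : Set (Phys m × ℝ)))) {r : ℝ}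
    (hr : 0 < r) : ∃ N : ℕ, ∀ (u : Phys m → ℝ≥0∞) (C : ℝ≥0∞),
      (∀ x, stripSum Γ (Set.Icc (-r) r) u x ≤ C) →
        ∀ y x, stripSum Γ {z | z + y ∈ Set.Icc (-r) r} u x ≤ N * C := by
  obtain ⟨N, hN⟩ := exists_stripSum_le hΓ hr (r + 1)
  refine ⟨N, fun u C hC y x => ?_⟩
  obtain ⟨_, ⟨γ, hγ, rfl⟩, hd⟩ := hΓ.exists_dist_lt (-y) one_pos
  refine le_trans ?_ (hN u C hC (γ.1 + x))
  rw [← stripSum_translate _ _ _ (⟨γ, hγ⟩ : Γ)]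
  refine stripSum_mono (fun z hz => ?_) u x
  rw [Real.dist_eq, abs_lt] at hd
  simp only [Set.mem_ofPred_eq, Set.mem_Icc] at hz ⊢
  constructor <;> linarith [hz.1, hz.2, hd.1, hd.2]

/-- A function whose sums over the points of a model set are bounded, uniformly over all translates,
is integrable: unfold the integral of `u` over the strip along a fundamental domain. -/
theorem lintegral_lt_top_of_stripSum_le [DiscreteTopology Γ] [IsZLattice ℝ Γ]
    (hΓ : Dense (Prod.snd '' (Γ : Set (Phys m × ℝ)))) {r : ℝ} (hr : 0 < r) {u : Phys m → ℝ≥0∞}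
    (hu : Measurable u) {C : ℝ≥0∞} (hC : C < ∞)
    (h : ∀ x, stripSum Γ (Set.Icc (-r) r) u x ≤ C) : ∫⁻ x, u x < ∞ := by
  obtain ⟨N, hN⟩ := exists_stripSum_shift_le hΓ hr
  set b := (Module.Free.chooseBasis ℤ Γ).ofZLatticeBasis ℝ Γ
  have hD : IsAddFundamentalDomain Γ (ZSpan.fundamentalDomain b) volume :=
    ZLattice.isAddFundamentalDomain _ _
  -- the integral of `w` is `2 r ∫ u`; unfolded, it is an integral of sums bounded by `N * C`
  set w : Phys m × ℝ → ℝ≥0∞ := fun z => u z.1 * (Set.Icc (-r) r).indicator 1 z.2 with hw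
  have hwm : Measurable w := (hu.comp measurable_fst).mul
    ((measurable_one.indicator measurableSet_Icc).comp measurable_snd)
  have e1 : ∫⁻ z, w z = (∫⁻ x, u x) * ENNReal.ofReal (2 * r) := by
    rw [hw, Measure.volume_eq_prod, lintegral_prod_mul hu.aemeasurable
      (measurable_one.indicator measurableSet_Icc).aemeasurable,
      lintegral_indicator_one measurableSet_Icc, Real.volume_Icc]
    ring_nf
  have e2 : ∫⁻ z, w z ≤ N * C * volume (ZSpan.fundamentalDomain b) := by
    have hterm : ∀ γ : Γ, AEMeasurable (fun z => w (γ +ᵥ z))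
        (volume.restrict (ZSpan.fundamentalDomain b)) :=
      fun γ => (hwm.comp (measurable_const_vadd γ)).aemeasurable
    rw [hD.lintegral_eq_tsum'', ← lintegral_tsum hterm]
    refine (lintegral_mono (g := fun _ => N * C) fun z => ?_).trans_eq (by simp)
    refine le_trans (le_of_eq ?_) (hN u C h z.2 z.1)
    refine tsum_congr fun γ => ?_
    change u ((γ : Phys m × ℝ).1 + z.1) *
      (Set.Icc (-r) r).indicator 1 ((γ : Phys m × ℝ).2 + z.2) = _
    by_cases hz : (γ : Phys m × ℝ).2 + z.2 ∈ Set.Icc (-r) r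
    · rw [Set.indicator_of_mem hz, Set.indicator_of_mem (by exact hz)]; simp
    · rw [Set.indicator_of_notMem hz, Set.indicator_of_notMem (by exact hz)]; simp
  have e3 : (N : ℝ≥0∞) * C * volume (ZSpan.fundamentalDomain b) < ∞ :=
    ENNReal.mul_lt_top (ENNReal.mul_lt_top (by simp) hC)
      (ZSpan.fundamentalDomain_isBounded b).measure_lt_top
  rw [e1] at e2
  by_contra hinf
  rw [not_lt, top_le_iff] at hinf
  rw [hinf, ENNReal.top_mul (by simpa using hr)] at e2
  exact absurd e3 (not_lt.2 e2)

end Strip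

/-! ### Periodization of a function along a strip -/

section Periodization

variable {m : ℕ} {Γ : Submodule ℤ (Phys m × ℝ)}

/-- The `Γ`-periodization of the function `(x, y) ↦ p x · 1_[-r, r] y`. -/
noncomputable def stripPeriodization (Γ : Submodule ℤ (Phys m × ℝ)) (r : ℝ) (p : Phys m → ℂ)
    (z : Phys m × ℝ) : ℂ :=
  ∑' γ : Γ, (Set.Icc (-r) r).indicator (fun _ => p ((γ : Phys m × ℝ).1 + z.1))
    ((γ : Phys m × ℝ).2 + z.2)

theorem stripPeriodization_add (r : ℝ) (p : Phys m → ℂ) {γ₀ : Phys m × ℝ} (hγ₀ : γ₀ ∈ Γ)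
    (z : Phys m × ℝ) :
    stripPeriodization Γ r p (z + γ₀) = stripPeriodization Γ r p z := by
  unfold stripPeriodization
  rw [← (Equiv.addRight (⟨γ₀, hγ₀⟩ : Γ)).tsum_eq (fun γ : Γ =>
    (Set.Icc (-r) r).indicator (fun _ => p ((γ : Phys m × ℝ).1 + z.1))
    ((γ : Phys m × ℝ).2 + z.2))]
  refine tsum_congr fun γ => ?_
  simp only [Equiv.coe_addRight, Submodule.coe_add, Prod.fst_add, Prod.snd_add]
  rw [add_comm z.1, add_comm z.2, ← add_assoc, ← add_assoc]

theorem measurable_strip_term {p : Phys m → ℂ} (hp : Measurable p) (r : ℝ) (γ : Phys m × ℝ) :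
    Measurable fun z : Phys m × ℝ =>
      (Set.Icc (-r) r).indicator (fun _ => p (γ.1 + z.1)) (γ.2 + z.2) := by
  have : (fun z : Phys m × ℝ =>
      (Set.Icc (-r) r).indicator (fun _ => p (γ.1 + z.1)) (γ.2 + z.2))
      = {z : Phys m × ℝ | γ.2 + z.2 ∈ Set.Icc (-r) r}.indicator (fun z => p (γ.1 + z.1)) := by
    ext z
    rfl
  rw [this]
  refine Measurable.indicator (hp.comp (measurable_fst.const_add _)) ?_
  exact (measurable_snd.const_add _) measurableSet_Icc

theorem measurable_stripPeriodization [Countable Γ] {p : Phys m → ℂ} (hp : Measurable p) (r : ℝ) :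
    Measurable (stripPeriodization Γ r p) :=
  Measurable.tsum fun γ => measurable_strip_term hp r γ

theorem tsum_enorm_strip_term (r : ℝ) (p : Phys m → ℂ) (z : Phys m × ℝ) :
    ∑' γ : Γ, ‖(Set.Icc (-r) r).indicator (fun _ => p ((γ : Phys m × ℝ).1 + z.1))
      ((γ : Phys m × ℝ).2 + z.2)‖ₑ = stripSum Γ {y | y + z.2 ∈ Set.Icc (-r) r}
        (fun x => ‖p x‖ₑ) z.1 := by
  refine tsum_congr fun γ => ?_
  by_cases h : (γ : Phys m × ℝ).2 + z.2 ∈ Set.Icc (-r) r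
  · rw [Set.indicator_of_mem h, Set.indicator_of_mem (by exact h)]
  · rw [Set.indicator_of_notMem h, Set.indicator_of_notMem (by exact h), enorm_zero]

/-- No summability is needed: the junk value `0` of a divergent sum satisfies the bound. -/
theorem enorm_tsum_le {ι : Type*} (a : ι → ℂ) : ‖∑' i, a i‖ₑ ≤ ∑' i, ‖a i‖ₑ := by
  by_cases h : ∑' i, ‖a i‖ₑ = ∞
  · rw [h]; exact le_top
  · have hs : Summable fun i => ‖a i‖ := by
      have := ENNReal.summable_toReal h
      simpa using this
    rw [← ofReal_norm, ← ENNReal.ofReal_toReal h]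
    refine ENNReal.ofReal_le_ofReal ((norm_tsum_le_tsum_norm hs).trans_eq ?_)
    rw [ENNReal.tsum_toReal_eq (fun _ => enorm_ne_top)]
    simp

theorem exists_norm_stripPeriodization_le (hΓ : Dense (Prod.snd '' (Γ : Set (Phys m × ℝ))))
    {r : ℝ} (hr : 0 < r) {p : Phys m → ℂ} {C : ℝ≥0∞} (hC : C < ∞)
    (h : ∀ x, stripSum Γ (Set.Icc (-r) r) (fun x => ‖p x‖ₑ) x ≤ C) :
    ∃ C' : ℝ, ∀ z, ‖stripPeriodization Γ r p z‖ ≤ C' := by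
  obtain ⟨N, hN⟩ := exists_stripSum_shift_le hΓ hr
  have hfin : (N : ℝ≥0∞) * C ≠ ∞ := (ENNReal.mul_lt_top (by simp) hC).ne
  refine ⟨((N : ℝ≥0∞) * C).toReal, fun z => ?_⟩
  have h1 : ‖stripPeriodization Γ r p z‖ₑ ≤ N * C := by
    refine (enorm_tsum_le _).trans ?_
    rw [tsum_enorm_strip_term]
    exact hN _ C h _ _
  rw [← toReal_enorm]
  exact ENNReal.toReal_mono hfin h1

/-- The Fourier coefficients of the periodization over a fundamental domain are the values of the
Fourier transform of the unfolded function on the dual lattice. -/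
theorem setIntegral_stripPeriodization [DiscreteTopology Γ] [IsZLattice ℝ Γ]
    (hΓ : Dense (Prod.snd '' (Γ : Set (Phys m × ℝ)))) {r : ℝ} (hr : 0 < r) {p : Phys m → ℂ}
    (hp : Measurable p) {C : ℝ≥0∞} (hC : C < ∞)
    (h : ∀ x, stripSum Γ (Set.Icc (-r) r) (fun x => ‖p x‖ₑ) x ≤ C)
    {D : Set (Phys m × ℝ)} (hD : IsAddFundamentalDomain Γ D volume)
    {η : Phys m × ℝ} (hη : η ∈ dualLattice Γ) :
    ∫ z in D, Complex.exp ((-(2 * Real.pi * (⟪z.1, η.1⟫_ℝ + z.2 * η.2)) : ℝ) * Complex.I) *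
      stripPeriodization Γ r p z
    = ((2 * r * Real.sinc (Real.pi * (2 * r) * η.2) : ℝ) : ℂ) * 𝓕 p η.1 := by
  have hpi : Integrable p := ⟨hp.aestronglyMeasurable,
    lintegral_lt_top_of_stripSum_le hΓ hr hp.enorm hC h⟩
  set e : Phys m × ℝ → ℂ := fun z =>
    Complex.exp ((-(2 * Real.pi * (⟪z.1, η.1⟫_ℝ + z.2 * η.2)) : ℝ) * Complex.I) with he
  have hec : Continuous e := by fun_prop
  have hen : ∀ z, ‖e z‖ = 1 := fun z => Complex.norm_exp_ofReal_mul_I _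
  have heper : ∀ γ ∈ Γ, ∀ z, e (γ + z) = e z := by
    intro γ hγ z
    obtain ⟨n, hn⟩ := hη γ hγ
    simp only [he]
    rw [Complex.exp_eq_exp_iff_exists_int]
    refine ⟨-n, ?_⟩
    have : ⟪(γ + z).1, η.1⟫_ℝ + (γ + z).2 * η.2 = n + (⟪z.1, η.1⟫_ℝ + z.2 * η.2) := by
      rw [← hn, Prod.fst_add, Prod.snd_add, inner_add_left]; ring
    rw [this]; push_cast; ring
  set W : Phys m × ℝ → ℂ := fun z => e z * (Set.Icc (-r) r).indicator (fun _ => p z.1) z.2 with hW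
  have hWprod : ∀ z, W z = (Complex.exp (↑(-2 * Real.pi * ⟪z.1, η.1⟫_ℝ) * Complex.I) • p z.1) *
      (Complex.exp (↑(-2 * Real.pi * z.2 * η.2) * Complex.I) •
        (Set.Icc (-r) r).indicator (fun _ => (1 : ℂ)) z.2) := by
    intro z
    have e1 : e z = Complex.exp (↑(-2 * Real.pi * ⟪z.1, η.1⟫_ℝ) * Complex.I) *
        Complex.exp (↑(-2 * Real.pi * z.2 * η.2) * Complex.I) := by
      rw [← Complex.exp_add]; simp only [he]; congr 1; push_cast; ring
    by_cases hz : z.2 ∈ Set.Icc (-r) r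
    · simp only [hW, Set.indicator_of_mem hz, e1, smul_eq_mul]; ring
    · simp only [hW, Set.indicator_of_notMem hz, smul_eq_mul, mul_zero]
  have hWi : Integrable W := by
    have hmul := hpi.mul_prod (integrable_indicator_Icc r)
    refine hmul.mono ?_ (Eventually.of_forall fun z => ?_)
    · have := measurable_strip_term hp r 0
      simp only [Prod.fst_zero, Prod.snd_zero, zero_add] at this
      exact (hec.measurable.mul this).aestronglyMeasurable
    · simp only [hW, norm_mul, hen, one_mul]
      by_cases hz : z.2 ∈ Set.Icc (-r) r <;> simp [hz]
  have hWint : ∫ z, W z = ((2 * r * Real.sinc (Real.pi * (2 * r) * η.2) : ℝ) : ℂ) * 𝓕 p η.1 := by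
    simp_rw [hWprod]
    rw [Measure.volume_eq_prod, integral_prod_mul
      (fun x : Phys m => Complex.exp (↑(-2 * Real.pi * ⟪x, η.1⟫_ℝ) * Complex.I) • p x)
      (fun y : ℝ => Complex.exp (↑(-2 * Real.pi * y * η.2) * Complex.I) •
        (Set.Icc (-r) r).indicator (fun _ => (1 : ℂ)) y),
      ← Real.fourier_eq', ← Real.fourier_real_eq_integral_exp_smul, fourier_indicator_Icc hr,
      mul_comm]
  rw [← hWint, hD.integral_eq_tsum'' W hWi]
  have hterm : ∀ γ : Γ, ∀ z, W (γ +ᵥ z) = e z *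
      (Set.Icc (-r) r).indicator (fun _ => p ((γ : Phys m × ℝ).1 + z.1))
        ((γ : Phys m × ℝ).2 + z.2) := by
    intro γ z
    change W ((γ : Phys m × ℝ) + z) = _
    simp only [hW]
    rw [heper _ γ.2]
    rfl
  simp_rw [hterm]
  rw [← integral_tsum]
  · refine integral_congr_ae (Eventually.of_forall fun z => ?_)
    simp only [stripPeriodization]
    rw [tsum_mul_left]
  · intro γ
    exact (hec.measurable.mul (measurable_strip_term hp r γ)).aestronglyMeasurable
  · have := hD.lintegral_eq_tsum'' (fun z => ‖W z‖ₑ)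
    simp_rw [hterm] at this
    rw [← this]
    exact hWi.2.ne

/-- As a function of the second coordinate the periodization is continuous wherever no lattice point
meets the boundary of the window. -/
theorem continuousAt_stripPeriodization (hΓ : Dense (Prod.snd '' (Γ : Set (Phys m × ℝ))))
    {r : ℝ} (hr : 0 < r) {p : Phys m → ℂ} {C : ℝ≥0∞} (hC : C < ∞)
    (h : ∀ x, stripSum Γ (Set.Icc (-r) r) (fun x => ‖p x‖ₑ) x ≤ C) (x : Phys m) {y : ℝ}
    (hy : ∀ γ ∈ Γ, γ.2 + y ≠ r ∧ γ.2 + y ≠ -r) :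
    ContinuousAt (fun y => stripPeriodization Γ r p (x, y)) y := by
  obtain ⟨N, hN⟩ := exists_stripSum_le hΓ hr (r + |y| + 1)
  have hfin : stripSum Γ (Set.Icc (-(r + |y| + 1)) (r + |y| + 1)) (fun x => ‖p x‖ₑ) x ≠ ∞ :=
    ((hN _ C h x).trans_lt (ENNReal.mul_lt_top (by simp) hC)).ne
  have hsum := ENNReal.summable_toReal hfin
  refine tendsto_tsum_of_dominated_convergence hsum (fun γ => ?_) ?_
  · -- each term is locally constant at `y`
    have hyγ := hy γ γ.2
    refine Tendsto.congr' (f₁ := fun _ => _) ?_ tendsto_const_nhds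
    have hne : (γ : Phys m × ℝ).2 + y ∉ frontier (Set.Icc (-r) r) := by
      rw [frontier_Icc (by linarith)]
      simp [hyγ.1, hyγ.2]
    have hcont : Tendsto (fun y' => (γ : Phys m × ℝ).2 + y') (𝓝 y)
      (𝓝 ((γ : Phys m × ℝ).2 + y)) := (continuous_const.add continuous_id).continuousAt
    by_cases hmem : (γ : Phys m × ℝ).2 + y ∈ Set.Icc (-r) r
    · have hint : Set.Icc (-r) r ∈ 𝓝 ((γ : Phys m × ℝ).2 + y) := by
        rw [← mem_interior_iff_mem_nhds]
        by_contra hn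
        exact hne ⟨subset_closure hmem, hn⟩
      filter_upwards [hcont.eventually_mem hint] with y' hy'
      rw [Set.indicator_of_mem hmem, Set.indicator_of_mem hy']
    · filter_upwards [hcont.eventually_mem (isClosed_Icc.isOpen_compl.mem_nhds hmem)] with y' hy'
      rw [Set.indicator_of_notMem hmem, Set.indicator_of_notMem hy']
  · filter_upwards [Metric.ball_mem_nhds y one_pos] with y' hy' γ
    rw [Metric.mem_ball, Real.dist_eq, abs_lt] at hy'
    by_cases hmem : (γ : Phys m × ℝ).2 + y' ∈ Set.Icc (-r) r
    · have : (γ : Phys m × ℝ).2 ∈ Set.Icc (-(r + |y| + 1)) (r + |y| + 1) := by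
        constructor <;> linarith [hmem.1, hmem.2, neg_abs_le y, le_abs_self y, hy'.1, hy'.2]
      rw [Set.indicator_of_mem hmem, Set.indicator_of_mem this, toReal_enorm]
    · rw [Set.indicator_of_notMem hmem, norm_zero]; exact ENNReal.toReal_nonneg

end Periodization

/-! ### Constancy of periodizations and the dual lattice -/

section Constancy

variable {m : ℕ} {Γ : Submodule ℤ (Phys m × ℝ)}

/-- Every linear functional on `ℝ^m × ℝ` is given by the orthogonal-sum inner product. -/
theorem exists_eq_inner_add_mul (χ : Phys m × ℝ →ₗ[ℝ] ℝ) :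
    ∃ η : Phys m × ℝ, ∀ z, χ z = ⟪z.1, η.1⟫_ℝ + z.2 * η.2 := by
  let φ : Phys m →L[ℝ] ℝ := LinearMap.toContinuousLinearMap (χ ∘ₗ LinearMap.inl ℝ (Phys m) ℝ)
  refine ⟨((InnerProductSpace.toDual ℝ (Phys m)).symm φ, χ (0, 1)), fun z => ?_⟩
  rw [real_inner_comm, InnerProductSpace.toDual_symm_apply]
  have : z = (z.1, 0) + z.2 • ((0, 1) : Phys m × ℝ) := by
    ext <;> simp
  conv_lhs => rw [this, map_add, map_smul]
  simp [φ]

/-- A character of `(ℝ^m × ℝ) / Γ` integrates to zero over a fundamental domain unless trivial. -/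
theorem setIntegral_character [DiscreteTopology Γ] [IsZLattice ℝ Γ]
    {D : Set (Phys m × ℝ)} (hD : IsAddFundamentalDomain Γ D volume)
    {η : Phys m × ℝ} (hη : η ∈ dualLattice Γ) :
    ∫ z in D, Complex.exp ((-(2 * Real.pi * (⟪z.1, η.1⟫_ℝ + z.2 * η.2)) : ℝ) * Complex.I)
      = if η = 0 then (ZLattice.covolume Γ : ℂ) else 0 := by
  split_ifs with h0
  · subst h0
    simp [ZLattice.covolume_eq_measure_fundamentalDomain Γ volume hD]
  set e : Phys m × ℝ → ℂ := fun z =>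
    Complex.exp ((-(2 * Real.pi * (⟪z.1, η.1⟫_ℝ + z.2 * η.2)) : ℝ) * Complex.I) with he
  have hadd : ∀ v z, e (v + z) = e v * e z := by
    intro v z
    simp only [he]
    rw [← Complex.exp_add, Prod.fst_add, Prod.snd_add, inner_add_left]
    congr 1; push_cast; ring
  have hΓ1 : ∀ γ ∈ Γ, e γ = 1 := by
    intro γ hγ
    obtain ⟨n, hn⟩ := hη γ hγ
    simp only [he]
    rw [Complex.exp_eq_one_iff]
    refine ⟨-n, ?_⟩
    rw [hn]; push_cast; ring
  have hq : 0 < ⟪η.1, η.1⟫_ℝ + η.2 * η.2 := by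
    by_contra hle
    have h1 := real_inner_self_nonneg (x := η.1)
    have h2 := mul_self_nonneg η.2
    have h3 : ⟪η.1, η.1⟫_ℝ = 0 := by linarith
    have h4 : η.2 * η.2 = 0 := by linarith
    exact h0 (Prod.ext (inner_self_eq_zero.1 h3) (mul_self_eq_zero.1 h4))
  set q := ⟪η.1, η.1⟫_ℝ + η.2 * η.2 with hqdef
  -- translating by half a period changes the sign of the character
  set v : Phys m × ℝ := (1 / (2 * q)) • η with hv
  have hev : e v = -1 := by
    simp only [he, hv, Prod.smul_fst, Prod.smul_snd, inner_smul_left, smul_eq_mul]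
    have : -(2 * Real.pi * ((conj (1 / (2 * q) : ℝ) : ℝ) * ⟪η.1, η.1⟫_ℝ + 1 / (2 * q) * η.2 * η.2))
        = -Real.pi := by
      have h1 : 1 / (2 * q) * ⟪η.1, η.1⟫_ℝ + 1 / (2 * q) * η.2 * η.2 = 1 / 2 := by
        rw [mul_assoc, ← mul_add, ← hqdef]; field_simp
      rw [conj_trivial, h1]; ring
    rw [this]
    simp [Complex.exp_neg]
  have hDv : IsAddFundamentalDomain Γ (v +ᵥ D) volume := hD.vadd_of_comm v
  have hinv : ∀ (γ : Γ) z, e (γ +ᵥ z) = e z := by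
    intro γ z
    change e ((γ : Phys m × ℝ) + z) = _
    rw [hadd, hΓ1 _ γ.2, one_mul]
  have h1 := hD.setIntegral_eq hDv hinv
  have h2 : ∫ z in v +ᵥ D, e z = ∫ z in D, e (v + z) := by
    have := (measurePreserving_add_left (volume : Measure (Phys m × ℝ)) v).setIntegral_image_emb
      (measurableEmbedding_addLeft v) e D
    exact this
  rw [h2] at h1
  simp_rw [hadd, hev] at h1
  rw [integral_const_mul] at h1
  have h3 : (2 : ℂ) * ∫ z in D, e z = 0 := by linear_combination h1
  simpa using h3

theorem ae_forall_add_ne [Countable Γ] (r : ℝ) :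
    ∀ᵐ y : ℝ, ∀ γ ∈ Γ, γ.2 + y ≠ r ∧ γ.2 + y ≠ -r := by
  have : ∀ᵐ y : ℝ, ∀ γ : Γ, (γ : Phys m × ℝ).2 + y ≠ r ∧ (γ : Phys m × ℝ).2 + y ≠ -r := by
    rw [ae_all_iff]
    intro γ
    have h1 : ∀ᵐ y : ℝ, y ≠ r - (γ : Phys m × ℝ).2 := by simp [ae_iff, measure_singleton]
    have h2 : ∀ᵐ y : ℝ, y ≠ -r - (γ : Phys m × ℝ).2 := by simp [ae_iff, measure_singleton]
    filter_upwards [h1, h2] with y hy1 hy2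
    exact ⟨fun h => hy1 (by linarith), fun h => hy2 (by linarith)⟩
  filter_upwards [this] with y hy γ hγ using hy ⟨γ, hγ⟩

variable [DiscreteTopology Γ] [IsZLattice ℝ Γ]

/-- If the sums of `p` over all translates of the model set have the same value, then the
periodization, being continuous in the second coordinate at almost all points and constant on a
dense set of second coordinates, is almost everywhere constant. -/
theorem stripPeriodization_ae_eq_const (hΓ : Dense (Prod.snd '' (Γ : Set (Phys m × ℝ)))) {r : ℝ}
    (hr : 0 < r) {p : Phys m → ℂ} (hp : Measurable p) {C : ℝ≥0∞} (hC : C < ∞)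
    (h : ∀ x, stripSum Γ (Set.Icc (-r) r) (fun x => ‖p x‖ₑ) x ≤ C) {c : ℂ}
    (hc : ∀ x, stripPeriodization Γ r p (x, 0) = c) :
    ∀ᵐ z, stripPeriodization Γ r p z = c := by
  have hm : MeasurableSet {z | stripPeriodization Γ r p z = c} :=
    measurable_stripPeriodization hp r (measurableSet_singleton c)
  rw [Measure.volume_eq_prod, Measure.ae_prod_iff_ae_ae hm]
  refine Eventually.of_forall fun x => ?_
  filter_upwards [ae_forall_add_ne (Γ := Γ) r] with y hy
  have hcont := continuousAt_stripPeriodization hΓ hr hC h x hy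
  have hfreq : ∃ᶠ y' in 𝓝 y, stripPeriodization Γ r p (x, y') = c := by
    -- by periodicity the value at `(x, γ.2)` is the one at `(x - γ.1, 0)`
    rw [frequently_iff]
    intro U hU
    obtain ⟨V, hVU, hVo, hyV⟩ := mem_nhds_iff.1 hU
    obtain ⟨_, hV, ⟨γ, hγ, rfl⟩⟩ := hΓ.inter_open_nonempty V hVo ⟨y, hyV⟩
    refine ⟨γ.2, hVU hV, ?_⟩
    have := stripPeriodization_add r p hγ (x - γ.1, 0)
    rw [hc] at this
    rw [← this]
    congr 1
    ext <;> simp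
  exact isClosed_singleton.mem_of_frequently_of_tendsto hfreq hcont

/-- A constant restriction to the physical space determines the Fourier transform of `p` at the
first coordinates of the dual lattice. -/
theorem fourier_of_stripPeriodization_eq_const
    (hΓ : Dense (Prod.snd '' (Γ : Set (Phys m × ℝ)))) {r : ℝ}
    (hr : 0 < r) {p : Phys m → ℂ} (hp : Measurable p) {C : ℝ≥0∞} (hC : C < ∞)
    (h : ∀ x, stripSum Γ (Set.Icc (-r) r) (fun x => ‖p x‖ₑ) x ≤ C) {c : ℂ}
    (hc : ∀ x, stripPeriodization Γ r p (x, 0) = c) {η : Phys m × ℝ} (hη : η ∈ dualLattice Γ) :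
    ((2 * r * Real.sinc (Real.pi * (2 * r) * η.2) : ℝ) : ℂ) * 𝓕 p η.1
      = if η = 0 then (ZLattice.covolume Γ : ℂ) * c else 0 := by
  have hD : IsAddFundamentalDomain Γ (ZSpan.fundamentalDomain
    ((Module.Free.chooseBasis ℤ Γ).ofZLatticeBasis ℝ Γ)) volume :=
    ZLattice.isAddFundamentalDomain _ _
  rw [← setIntegral_stripPeriodization hΓ hr hp hC h hD hη]
  have hae := stripPeriodization_ae_eq_const hΓ hr hp hC h hc
  have e1 := setIntegral_character hD hη
  rw [integral_congr_ae (g := fun z => Complex.exp ((-(2 * Real.pi * (⟪z.1, η.1⟫_ℝ + z.2 * η.2)) : ℝ)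
    * Complex.I) * c), integral_mul_const, e1]
  · split_ifs <;> simp
  · filter_upwards [ae_restrict_of_ae hae] with z hz
    rw [hz]

/-- Conversely, if the Fourier coefficients of the periodization are those of a constant, then it is
constant almost everywhere; genericity of the model set allows one to restrict to the physical
space. -/
theorem ae_stripPeriodization_eq_const_of_fourier
    (hΓ : Dense (Prod.snd '' (Γ : Set (Phys m × ℝ)))) {r : ℝ}
    (hr : 0 < r) (hgen : ∀ γ ∈ Γ, γ.2 ≠ r ∧ γ.2 ≠ -r) {p : Phys m → ℂ} (hp : Measurable p)
    {C : ℝ≥0∞} (hC : C < ∞)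
    (h : ∀ x, stripSum Γ (Set.Icc (-r) r) (fun x => ‖p x‖ₑ) x ≤ C) {c : ℂ}
    (hη : ∀ η ∈ dualLattice Γ, ((2 * r * Real.sinc (Real.pi * (2 * r) * η.2) : ℝ) : ℂ) * 𝓕 p η.1
      = if η = 0 then (ZLattice.covolume Γ : ℂ) * c else 0) :
    ∀ᵐ x, stripPeriodization Γ r p (x, 0) = c := by
  set b := (Module.Free.chooseBasis ℤ Γ).ofZLatticeBasis ℝ Γ
  have hD : IsAddFundamentalDomain Γ (ZSpan.fundamentalDomain b) volume :=
    ZLattice.isAddFundamentalDomain _ _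
  obtain ⟨C', hC'⟩ := exists_norm_stripPeriodization_le hΓ hr hC h
  have hm := measurable_stripPeriodization (Γ := Γ) hp r
  have hfinD : volume (ZSpan.fundamentalDomain b) < ∞ :=
    (ZSpan.fundamentalDomain_isBounded b).measure_lt_top
  have : IsFiniteMeasure (volume.restrict (ZSpan.fundamentalDomain b)) :=
    ⟨by simpa using hfinD⟩
  have hz := ae_eq_zero_of_lattice_fourier (μ := volume)
    (F := fun z => stripPeriodization Γ r p z - c)
    (hm.sub_const c) (C := C' + ‖c‖) (fun z => (norm_sub_le _ _).trans (by gcongr; exact hC' z))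
    (fun γ hγ z => by rw [stripPeriodization_add r p hγ]) hD (by
      intro χ hχ
      obtain ⟨η, hη'⟩ := exists_eq_inner_add_mul χ
      have hηd : η ∈ dualLattice Γ := fun γ hγ => by
        obtain ⟨n, hn⟩ := hχ γ hγ
        exact ⟨n, by rw [← hη', hn]⟩
      simp only [hη', mul_sub]
      have hec : Continuous fun z : Phys m × ℝ =>
        Complex.exp ((-(2 * Real.pi * (⟪z.1, η.1⟫_ℝ + z.2 * η.2)) : ℝ) * Complex.I) := by fun_prop
      have hen : ∀ z : Phys m × ℝ,
        ‖Complex.exp ((-(2 * Real.pi * (⟪z.1, η.1⟫_ℝ + z.2 * η.2)) : ℝ) * Complex.I)‖ = 1 :=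
        fun z => Complex.norm_exp_ofReal_mul_I _
      rw [integral_sub, setIntegral_stripPeriodization hΓ hr hp hC h hD hηd, hη η hηd,
        integral_mul_const, setIntegral_character hD hηd]
      · split_ifs <;> simp
      · refine Integrable.of_bound (C := C') (hec.measurable.mul hm).aestronglyMeasurable
          (Eventually.of_forall fun z => ?_)
        rw [norm_mul, hen, one_mul]; exact hC' z
      · refine Integrable.of_bound (C := ‖c‖) (hec.measurable.mul_const c).aestronglyMeasurable
          (Eventually.of_forall fun z => ?_)
        rw [norm_mul, hen, one_mul])
  have hz' : ∀ᵐ z : Phys m × ℝ, stripPeriodization Γ r p z = c := by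
    filter_upwards [hz] with z hz
    exact sub_eq_zero.1 hz
  rw [Measure.volume_eq_prod] at hz'
  filter_upwards [Measure.ae_ae_of_ae_prod hz'] with x hx
  -- `0` is a point of continuity in the second coordinate
  have hcont := continuousAt_stripPeriodization hΓ hr hC h x (y := 0)
    (fun γ hγ => by simpa using hgen γ hγ)
  have hfreq : ∃ᶠ y' in 𝓝 (0 : ℝ), stripPeriodization Γ r p (x, y') = c := by
    rw [frequently_iff]
    intro U hU
    obtain ⟨V, hVU, hVo, hyV⟩ := mem_nhds_iff.1 hU
    have hdense : Dense {y | stripPeriodization Γ r p (x, y) = c} := Measure.dense_of_ae hx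
    obtain ⟨y, hyV', hy⟩ := hdense.inter_open_nonempty V hVo ⟨0, hyV⟩
    exact ⟨y, hVU hyV', hy⟩
  exact isClosed_singleton.mem_of_frequently_of_tendsto hfreq hcont

end Constancy

/-! ### The density of a model set -/

section Density

theorem sum_ncard_le_ncard {α : Type*} {n : ℕ} {A : Fin n → Set α} {B : Set α} (hB : B.Finite)
    (hAB : ∀ j, A j ⊆ B) (hd : Pairwise fun i j => Disjoint (A i) (A j)) :
    ∑ j, (A j).ncard ≤ B.ncard := by
  classical
  have hA : ∀ j, (A j).Finite := fun j => hB.subset (hAB j)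
  calc ∑ j, (A j).ncard = ∑ j, (hA j).toFinset.card :=
        Finset.sum_congr rfl fun j _ => Set.ncard_eq_toFinset_card _ (hA j)
    _ = (Finset.univ.biUnion fun j => (hA j).toFinset).card := by
        rw [Finset.card_biUnion]
        intro i _ j _ hij
        exact Set.Finite.disjoint_toFinset.2 (hd hij)
    _ ≤ hB.toFinset.card := by
        refine Finset.card_le_card fun z hz => ?_
        simp only [Finset.mem_biUnion, Finset.mem_univ, true_and, Set.Finite.mem_toFinset] at hz ⊢
        obtain ⟨j, hj⟩ := hz
        exact hAB j hj
    _ = B.ncard := (Set.ncard_eq_toFinset_card _ hB).symm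

theorem ncard_le_sum_ncard {α : Type*} {n : ℕ} {A : Fin n → Set α} {B : Set α}
    (hA : ∀ j, (A j).Finite) (hAB : B ⊆ ⋃ j, A j) : B.ncard ≤ ∑ j, (A j).ncard := by
  classical
  have hB : B.Finite := (Set.finite_iUnion hA).subset hAB
  calc B.ncard = hB.toFinset.card := Set.ncard_eq_toFinset_card _ hB
    _ ≤ (Finset.univ.biUnion fun j => (hA j).toFinset).card := by
        refine Finset.card_le_card fun z hz => ?_
        rw [Set.Finite.mem_toFinset] at hz
        simpa using hAB hz
    _ ≤ ∑ j, (hA j).toFinset.card := Finset.card_biUnion_le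
    _ = ∑ j, (A j).ncard :=
        Finset.sum_congr rfl fun j _ => (Set.ncard_eq_toFinset_card _ (hA j)).symm

variable {m : ℕ}

/-- The vector of `ℝ^m` with all coordinates equal to `s`. -/
def diag (m : ℕ) (s : ℝ) : Phys m := WithLp.toLp 2 fun _ => s

theorem cube_eq_preimage (x : Phys m) (R : ℝ) :
    cube x R = (MeasurableEquiv.toLp 2 (Fin m → ℝ)).symm ⁻¹'
      Set.Icc (fun i => x i) (fun i => x i + R) := by
  ext y
  simp [cube, Set.mem_Icc, Pi.le_def, forall_and]

theorem measurableSet_cube (x : Phys m) (R : ℝ) : MeasurableSet (cube x R) := by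
  rw [cube_eq_preimage]
  exact (MeasurableEquiv.toLp 2 (Fin m → ℝ)).symm.measurable measurableSet_Icc

theorem volume_cube (x : Phys m) {R : ℝ} (hR : 0 ≤ R) :
    volume (cube x R) = ENNReal.ofReal (R ^ m) := by
  rw [cube_eq_preimage,
    (EuclideanSpace.volume_preserving_symm_measurableEquiv_toLp (Fin m)).measure_preimage
      measurableSet_Icc.nullMeasurableSet, Real.volume_Icc_pi]
  simp [ENNReal.ofReal_pow hR]

/-- The box `(x + R [0,1]^m) × [a, b]` in `ℝ^m × ℝ`. -/
def latticeBox (x : Phys m) (R a b : ℝ) : Set (Phys m × ℝ) := cube x R ×ˢ Set.Icc a b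

theorem volume_latticeBox (x : Phys m) {R a b : ℝ} (hR : 0 ≤ R) :
    volume (latticeBox x R a b) = ENNReal.ofReal (R ^ m * (b - a)) := by
  rw [latticeBox, Measure.volume_eq_prod, Measure.prod_prod, volume_cube x hR, Real.volume_Icc,
    ENNReal.ofReal_mul (by positivity)]

theorem isBounded_latticeBox (x : Phys m) (R a b : ℝ) :
    Bornology.IsBounded (latticeBox x R a b) := by
  refine Bornology.IsBounded.prod ?_ (Metric.isBounded_Icc a b)
  have h1 : IsCompact (Set.Icc (fun i => x i) (fun i => x i + R) : Set (Fin m → ℝ)) :=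
    isCompact_Icc
  have h2 := h1.image (PiLp.continuous_toLp 2 (fun _ : Fin m => ℝ))
  refine h2.isBounded.subset fun y hy => ⟨fun i => y i, ?_, rfl⟩
  exact ⟨fun i => (hy i).1, fun i => (hy i).2⟩

variable {Γ : Submodule ℤ (Phys m × ℝ)}

theorem latticeBox_subset (x : Phys m) {R a b a' b' s : ℝ} (v : Phys m) (hv : ∀ i, |v i| ≤ s)
    (ha : a' ≤ a) (hb : b ≤ b') :
    latticeBox (x + v) R a b ⊆ latticeBox (x - diag m s) (R + 2 * s) a' b' := by
  rintro z ⟨hz1, hz2⟩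
  refine ⟨fun i => ?_, ha.trans hz2.1, hz2.2.trans hb⟩
  have h1 := hz1 i
  have h2 := abs_le.1 (hv i)
  simp only [PiLp.add_apply, PiLp.sub_apply, diag] at h1 ⊢
  constructor <;> linarith [h1.1, h1.2, h2.1, h2.2]

theorem ncard_latticeBox_translate (x : Phys m) (R a b : ℝ) {γ : Phys m × ℝ} (hγ : γ ∈ Γ) :
    ((Γ : Set (Phys m × ℝ)) ∩ latticeBox (x + γ.1) R (a + γ.2) (b + γ.2)).ncard
      = ((Γ : Set (Phys m × ℝ)) ∩ latticeBox x R a b).ncard := by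
  conv_rhs => rw [← Set.ncard_image_of_injective _ (add_left_injective γ)]
  congr 1
  ext z
  simp only [Set.mem_inter_iff, Set.mem_image, SetLike.mem_coe, latticeBox, Set.mem_prod, cube,
    Set.mem_ofPred_eq, Set.mem_Icc, PiLp.add_apply]
  constructor
  · rintro ⟨h1, h2, h3⟩
    refine ⟨z - γ, ⟨Γ.sub_mem h1 hγ, fun i => ?_, ?_⟩, by abel⟩
    · have := h2 i
      simp only [Prod.fst_sub, PiLp.sub_apply]
      constructor <;> linarith [this.1, this.2]
    · simp only [Prod.snd_sub]
      constructor <;> linarith [h3.1, h3.2]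
  · rintro ⟨w, ⟨h1, h2, h3⟩, rfl⟩
    refine ⟨Γ.add_mem h1 hγ, fun i => ?_, ?_⟩
    · have := h2 i
      simp only [Prod.fst_add, PiLp.add_apply]
      constructor <;> linarith [this.1, this.2]
    · simp only [Prod.snd_add]
      constructor <;> linarith [h3.1, h3.2]

variable [DiscreteTopology Γ] [IsZLattice ℝ Γ]

theorem finite_lattice_inter {S : Set (Phys m × ℝ)} (hS : Bornology.IsBounded S) :
    ((Γ : Set (Phys m × ℝ)) ∩ S).Finite := by
  have h := ZSpan.setFinite_inter ((Module.Free.chooseBasis ℤ Γ).ofZLatticeBasis ℝ Γ) hS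
  rw [(Module.Free.chooseBasis ℤ Γ).ofZLatticeBasis_span ℝ, Set.inter_comm] at h
  exact h

/-- The number of lattice points in a box is comparable to its volume, up to enlarging or shrinking
the box by the diameter of a fundamental domain. -/
theorem exists_count_bounds (Γ : Submodule ℤ (Phys m × ℝ)) [DiscreteTopology Γ] [IsZLattice ℝ Γ] :
    ∃ d : ℝ, 0 ≤ d ∧
      (∀ (x : Phys m) (R a b : ℝ), 0 ≤ R → a ≤ b →
        ZLattice.covolume Γ * ((Γ : Set (Phys m × ℝ)) ∩ latticeBox x R a b).ncard
          ≤ (R + 2 * d) ^ m * (b - a + 2 * d)) ∧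
      (∀ (x : Phys m) (R a b : ℝ), 2 * d ≤ R → 2 * d ≤ b - a →
        (R - 2 * d) ^ m * (b - a - 2 * d)
          ≤ ZLattice.covolume Γ * ((Γ : Set (Phys m × ℝ)) ∩ latticeBox x R a b).ncard) := by
  classical
  set B := (Module.Free.chooseBasis ℤ Γ).ofZLatticeBasis ℝ Γ
  set D := ZSpan.fundamentalDomain B with hDdef
  have hD : IsAddFundamentalDomain Γ D volume := ZLattice.isAddFundamentalDomain _ _
  have hDb : Bornology.IsBounded D := ZSpan.fundamentalDomain_isBounded B
  have hcov : ZLattice.covolume Γ = volume.real D :=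
    ZLattice.covolume_eq_measure_fundamentalDomain Γ volume hD
  obtain ⟨d, hd⟩ := hDb.exists_norm_le
  have hd0 : 0 ≤ max d 0 := le_max_right _ _
  have hcoord : ∀ z ∈ D, (∀ i, |z.1 i| ≤ max d 0) ∧ |z.2| ≤ max d 0 := by
    intro z hz
    have h1 := (hd z hz).trans (le_max_left d 0)
    exact ⟨fun i => (PiLp.norm_apply_le z.1 i).trans ((norm_fst_le z).trans h1),
      (norm_snd_le z).trans h1⟩
  have hvolfin : ∀ (γ : Γ), volume (γ +ᵥ D) = volume D := fun γ => measure_vadd volume γ D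
  refine ⟨max d 0, hd0, fun x R a b hR hab => ?_, fun x R a b hR hab => ?_⟩
  · set S := (Γ : Set (Phys m × ℝ)) ∩ latticeBox x R a b with hS
    have hfin : S.Finite := finite_lattice_inter (isBounded_latticeBox x R a b)
    have hsub : ∀ γ ∈ S, ∀ z ∈ D, γ + z ∈
        latticeBox (x - diag m (max d 0)) (R + 2 * max d 0) (a - max d 0) (b + max d 0) := by
      intro γ hγ z hz
      obtain ⟨h1, h2⟩ := hcoord z hz
      refine ⟨fun i => ?_, ?_⟩
      · have h3 := hγ.2.1 i
        have h4 := abs_le.1 (h1 i)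
        simp only [PiLp.sub_apply, diag, Prod.fst_add, PiLp.add_apply]
        constructor <;> linarith [h3.1, h3.2, h4.1, h4.2]
      · have h3 := hγ.2.2
        have h4 := abs_le.1 h2
        simp only [Prod.snd_add, Set.mem_Icc] at h3 ⊢
        constructor <;> linarith [h3.1, h3.2, h4.1, h4.2]
    set T : Finset Γ := hfin.toFinset.subtype (· ∈ Γ) with hT
    have hTc : T.card = S.ncard := by
      rw [Set.ncard_eq_toFinset_card _ hfin, hT, Finset.card_subtype, Finset.filter_true_of_mem]
      intro z hz
      exact (hfin.mem_toFinset.1 hz).1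
    have h1 : (T.card : ℝ≥0∞) * volume D ≤ volume (latticeBox (x - diag m (max d 0))
        (R + 2 * max d 0) (a - max d 0) (b + max d 0)) := by
      calc (T.card : ℝ≥0∞) * volume D = ∑ γ ∈ T, volume (γ +ᵥ D) := by simp [hvolfin]
        _ = volume (⋃ γ ∈ T, γ +ᵥ D) := by
            rw [measure_biUnion_finset₀]
            · exact fun γ _ γ' _ hne => hD.aedisjoint hne
            · exact fun γ _ => hD.nullMeasurableSet_vadd γ
        _ ≤ _ := by
            refine measure_mono (Set.iUnion₂_subset fun γ hγ => ?_)
            rintro _ ⟨z, hz, rfl⟩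
            refine hsub γ ?_ z hz
            simpa [hT] using hγ
    rw [volume_latticeBox _ (by linarith)] at h1
    have h2 := ENNReal.toReal_mono ENNReal.ofReal_ne_top h1
    rw [ENNReal.toReal_mul, ENNReal.toReal_natCast, ENNReal.toReal_ofReal (by
      have : 0 ≤ R + 2 * max d 0 := by linarith
      have : 0 ≤ b + max d 0 - (a - max d 0) := by linarith
      positivity), hTc] at h2
    rw [hcov, measureReal_def, mul_comm]
    refine h2.trans_eq ?_
    ring
  · set S := (Γ : Set (Phys m × ℝ)) ∩ latticeBox x R a b with hS
    have hfin : S.Finite := finite_lattice_inter (isBounded_latticeBox x R a b)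
    set T : Finset Γ := hfin.toFinset.subtype (· ∈ Γ) with hT
    have hTc : T.card = S.ncard := by
      rw [Set.ncard_eq_toFinset_card _ hfin, hT, Finset.card_subtype, Finset.filter_true_of_mem]
      intro z hz
      exact (hfin.mem_toFinset.1 hz).1
    have hcover : latticeBox (x + diag m (max d 0)) (R - 2 * max d 0) (a + max d 0) (b - max d 0)
        ⊆ ⋃ γ ∈ T, γ +ᵥ D := by
      intro z hz
      have hfl : ((ZSpan.floor B z : Phys m × ℝ)) ∈ Γ :=
        ((Module.Free.chooseBasis ℤ Γ).ofZLatticeBasis_span ℝ).le (ZSpan.floor B z).2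
      have hfr := ZSpan.fract_mem_fundamentalDomain B z
      have hzz : z = ZSpan.floor B z + ZSpan.fract B z := by
        rw [ZSpan.fract_apply]; abel
      obtain ⟨h1, h2⟩ := hcoord _ hfr
      set φ := ZSpan.fract B z
      set f : Phys m × ℝ := (ZSpan.floor B z : Phys m × ℝ)
      refine Set.mem_iUnion₂.2 ⟨⟨f, hfl⟩, ?_, φ, hfr, hzz.symm⟩
      simp only [hT, Finset.mem_subtype, hfin.mem_toFinset]
      refine ⟨hfl, fun i => ?_, ?_⟩
      · have h3 := hz.1 i
        rw [hzz] at h3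
        have h4 := abs_le.1 (h1 i)
        simp only [diag, Prod.fst_add, PiLp.add_apply] at h3
        constructor <;> linarith [h3.1, h3.2, h4.1, h4.2]
      · have h3 := hz.2
        rw [hzz] at h3
        have h4 := abs_le.1 h2
        simp only [Prod.snd_add, Set.mem_Icc] at h3 ⊢
        constructor <;> linarith [h3.1, h3.2, h4.1, h4.2]
    have h1 : volume (latticeBox (x + diag m (max d 0))
        (R - 2 * max d 0) (a + max d 0) (b - max d 0)) ≤ (T.card : ℝ≥0∞) * volume D := by
      calc _ ≤ volume (⋃ γ ∈ T, γ +ᵥ D) := measure_mono hcover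
        _ ≤ ∑ γ ∈ T, volume (γ +ᵥ D) := measure_biUnion_finset_le _ _
        _ = _ := by simp [hvolfin]
    rw [volume_latticeBox _ (by linarith)] at h1
    have h2 := ENNReal.toReal_mono (ENNReal.mul_lt_top (by simp) hDb.measure_lt_top).ne h1
    rw [ENNReal.toReal_mul, ENNReal.toReal_natCast, ENNReal.toReal_ofReal (by
      have : 0 ≤ R - 2 * max d 0 := by linarith
      have : 0 ≤ b - max d 0 - (a + max d 0) := by linarith
      positivity), hTc] at h2
    rw [hcov, measureReal_def, mul_comm (volume D).toReal]
    refine le_trans (le_of_eq ?_) h2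
    ring

/-- Upper bound for the number of lattice points over a cube, with second coordinate in `[a, b]`:
pack many disjoint translates of `[a, b]` by second coordinates of lattice points into one long
interval. -/
theorem exists_count_le (hΓ : Dense (Prod.snd '' (Γ : Set (Phys m × ℝ)))) {a b : ℝ} (hab : a ≤ b)
    {κ : ℝ} (hκ : 0 < κ) :
    ∃ c : ℝ, 0 ≤ c ∧ ∀ (x : Phys m) (R : ℝ), 0 ≤ R →
      (((Γ : Set (Phys m × ℝ)) ∩ latticeBox x R a b).ncard : ℝ)
        ≤ (R + c) ^ m * ((b - a + κ) / ZLattice.covolume Γ) := by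
  obtain ⟨d, hd0, hup, -⟩ := exists_count_bounds Γ
  have hV : 0 < ZLattice.covolume Γ := ZLattice.covolume_pos Γ volume
  set δ := κ / 2 with hδ
  have hδ0 : 0 < δ := by positivity
  set ℓ := b - a with hℓ
  -- with `n` translates the error `2 * d` in the length costs less than `δ` per translate
  obtain ⟨n, hn⟩ := exists_nat_gt (2 * d / δ)
  have hn0 : 0 < (n : ℝ) := lt_of_le_of_lt (by positivity) hn
  have hex : ∀ j : Fin n, ∃ γ ∈ Γ, γ.2 ∈ Set.Ioo (j * (ℓ + δ)) (j * (ℓ + δ) + δ) := by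
    intro j
    obtain ⟨_, h1, γ, hγ, rfl⟩ := hΓ.inter_open_nonempty _
      (isOpen_Ioo (a := (j : ℝ) * (ℓ + δ)) (b := j * (ℓ + δ) + δ)) (by simpa using hδ0)
    exact ⟨γ, hγ, h1⟩
  choose γ hγ hγ2 using hex
  set ρ := ∑ j, ‖(γ j).1‖ with hρ
  have hρ0 : 0 ≤ ρ := Finset.sum_nonneg fun _ _ => norm_nonneg _
  have hγρ : ∀ j i, |(γ j).1 i| ≤ ρ := fun j i =>
    (PiLp.norm_apply_le (γ j).1 i).trans
      (Finset.single_le_sum (f := fun j => ‖(γ j).1‖) (fun _ _ => norm_nonneg _) (Finset.mem_univ j))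
  refine ⟨2 * ρ + 2 * d, by positivity, fun x R hR => ?_⟩
  set big := (Γ : Set (Phys m × ℝ)) ∩
    latticeBox (x - diag m ρ) (R + 2 * ρ) a (a + n * (ℓ + δ)) with hbig
  have hℓ0 : 0 ≤ ℓ := by linarith
  have h1 : ∑ j : Fin n, ((Γ : Set (Phys m × ℝ)) ∩
      latticeBox (x + (γ j).1) R (a + (γ j).2) (b + (γ j).2)).ncard ≤ big.ncard := by
    refine sum_ncard_le_ncard (finite_lattice_inter (isBounded_latticeBox _ _ _ _)) ?_ ?_
    · intro j
      have hj1 : (j : ℝ) + 1 ≤ n := by exact_mod_cast j.2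
      have hj2 := hγ2 j
      refine Set.inter_subset_inter_right _ (latticeBox_subset _ _ (hγρ j) ?_ ?_)
      · have : 0 ≤ (j : ℝ) * (ℓ + δ) := by positivity
        linarith [hj2.1]
      · have : ((j : ℝ) + 1) * (ℓ + δ) ≤ n * (ℓ + δ) := by gcongr
        linarith [hj2.2]
    · -- the translates of `[a, b]` are disjoint
      have hlt : ∀ i j : Fin n, i < j → b + (γ i).2 < a + (γ j).2 := by
        intro i j hij
        have hij' : (i : ℝ) + 1 ≤ j := by exact_mod_cast hij
        have : ((i : ℝ) + 1) * (ℓ + δ) ≤ j * (ℓ + δ) := by gcongr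
        linarith [(hγ2 i).2, (hγ2 j).1]
      intro i j hij
      rw [Set.disjoint_left]
      rintro z ⟨-, -, hz1⟩ ⟨-, -, hz2⟩
      rcases lt_or_gt_of_ne hij with h | h
      · linarith [hlt i j h, hz1.2, hz2.1]
      · linarith [hlt j i h, hz1.1, hz2.2]
  simp only [ncard_latticeBox_translate x R a b (hγ _)] at h1
  rw [Finset.sum_const, Finset.card_univ, Fintype.card_fin, smul_eq_mul] at h1
  have h2 := hup (x - diag m ρ) (R + 2 * ρ) a (a + n * (ℓ + δ)) (by positivity)
    (by nlinarith)
  rw [← hbig] at h2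
  have h1' : (n : ℝ) * ((Γ : Set (Phys m × ℝ)) ∩ latticeBox x R a b).ncard ≤ big.ncard := by
    exact_mod_cast h1
  have h3 : a + n * (ℓ + δ) - a + 2 * d ≤ n * (ℓ + κ) := by
    rw [div_lt_iff₀ hδ0] at hn
    have : κ = δ + δ := by rw [hδ]; ring
    rw [this]; linarith
  have h4 : (R + 2 * ρ + 2 * d) ^ m * (a + n * (ℓ + δ) - a + 2 * d)
      ≤ (R + (2 * ρ + 2 * d)) ^ m * (n * (ℓ + κ)) := by
    rw [← add_assoc]; gcongr
  rw [← mul_div_assoc, le_div_iff₀ hV]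
  refine le_of_mul_le_mul_left ?_ hn0
  calc (n : ℝ) * (((Γ : Set (Phys m × ℝ)) ∩ latticeBox x R a b).ncard * ZLattice.covolume Γ)
      = ZLattice.covolume Γ * (n * ((Γ : Set (Phys m × ℝ)) ∩ latticeBox x R a b).ncard) := by ring
    _ ≤ ZLattice.covolume Γ * big.ncard := by gcongr
    _ ≤ (R + (2 * ρ + 2 * d)) ^ m * (n * (ℓ + κ)) := h2.trans h4
    _ = n * ((R + (2 * ρ + 2 * d)) ^ m * (ℓ + κ)) := by ring

/-- Lower bound for the number of lattice points over a cube: cover a long interval by translates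
of `[a, b]`. -/
theorem exists_le_count (hΓ : Dense (Prod.snd '' (Γ : Set (Phys m × ℝ)))) {a b : ℝ}
    {κ : ℝ} (hκ : 0 < κ) (hκ' : κ < b - a) :
    ∃ c : ℝ, 0 ≤ c ∧ ∀ (x : Phys m) (R : ℝ), c ≤ R →
      (R - c) ^ m * ((b - a - κ) / ZLattice.covolume Γ)
        ≤ (((Γ : Set (Phys m × ℝ)) ∩ latticeBox x R a b).ncard : ℝ) := by
  obtain ⟨d, hd0, -, hlow⟩ := exists_count_bounds Γ
  have hV : 0 < ZLattice.covolume Γ := ZLattice.covolume_pos Γ volume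
  set δ := κ / 2 with hδ
  have hδ0 : 0 < δ := by positivity
  have hκδ : κ = δ + δ := by rw [hδ]; ring
  set ℓ := b - a with hℓ
  have hℓδ : δ ≤ ℓ - δ := by linarith
  have hℓδ0 : 0 < ℓ - δ := by linarith
  -- with `n` translates the error `2 * d` in the length costs less than `δ` per translate
  obtain ⟨n, hn⟩ := exists_nat_gt (2 * d / δ)
  have hn0 : 0 < (n : ℝ) := lt_of_le_of_lt (by positivity) hn
  rw [div_lt_iff₀ hδ0] at hn
  have hex : ∀ j : Fin n, ∃ γ ∈ Γ, γ.2 ∈ Set.Ioo (j * (ℓ - δ)) (j * (ℓ - δ) + δ) := by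
    intro j
    obtain ⟨_, h1, γ, hγ, rfl⟩ := hΓ.inter_open_nonempty _
      (isOpen_Ioo (a := (j : ℝ) * (ℓ - δ)) (b := j * (ℓ - δ) + δ)) (by simpa using hδ0)
    exact ⟨γ, hγ, h1⟩
  choose γ hγ hγ2 using hex
  set ρ := ∑ j, ‖(γ j).1‖ with hρ
  have hρ0 : 0 ≤ ρ := Finset.sum_nonneg fun _ _ => norm_nonneg _
  have hγρ : ∀ j i, |(γ j).1 i| ≤ ρ := fun j i =>
    (PiLp.norm_apply_le (γ j).1 i).trans
      (Finset.single_le_sum (f := fun j => ‖(γ j).1‖) (fun _ _ => norm_nonneg _) (Finset.mem_univ j))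
  refine ⟨2 * ρ + 2 * d, by positivity, fun x R hR => ?_⟩
  set J := (Γ : Set (Phys m × ℝ)) ∩
    latticeBox (x + diag m ρ) (R - 2 * ρ) (a + δ) (a + δ + n * (ℓ - δ)) with hJ
  have h1 : J.ncard ≤ ∑ j : Fin n, ((Γ : Set (Phys m × ℝ)) ∩
      latticeBox (x + (γ j).1) R (a + (γ j).2) (b + (γ j).2)).ncard := by
    by_cases hJ' : n = 0
    · simp [hJ'] at hn0
    refine ncard_le_sum_ncard (fun j => finite_lattice_inter (isBounded_latticeBox _ _ _ _)) ?_
    rintro z ⟨hzΓ, hz1, hz2⟩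
    -- the index of the translate is found by division with remainder
    set t := (z.2 - (a + δ)) / (ℓ - δ) with ht
    have ht0 : 0 ≤ t := div_nonneg (by linarith [hz2.1]) hℓδ0.le
    have htn : t ≤ n := by rw [ht, div_le_iff₀ hℓδ0]; linarith [hz2.2]
    have hzt : z.2 = a + δ + t * (ℓ - δ) := by rw [ht]; field_simp; ring
    obtain ⟨j, hj1, hj2⟩ : ∃ j : Fin n, (j : ℝ) ≤ t ∧ t ≤ j + 1 := by
      rcases htn.lt_or_eq with h | h
      · exact ⟨⟨⌊t⌋₊, (Nat.floor_lt ht0).2 h⟩, Nat.floor_le ht0, (Nat.lt_floor_add_one t).le⟩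
      · refine ⟨⟨n - 1, by omega⟩, ?_, ?_⟩
        · simp only [Nat.cast_sub (Nat.one_le_iff_ne_zero.2 hJ')]
          push_cast; linarith
        · simp only [Nat.cast_sub (Nat.one_le_iff_ne_zero.2 hJ')]
          push_cast; linarith
    refine Set.mem_iUnion.2 ⟨j, hzΓ, fun i => ?_, ?_, ?_⟩
    · have h3 := hz1 i
      have h4 := abs_le.1 (hγρ j i)
      simp only [diag, PiLp.add_apply] at h3 ⊢
      constructor <;> linarith [h3.1, h3.2, h4.1, h4.2]
    · have : (j : ℝ) * (ℓ - δ) ≤ t * (ℓ - δ) := by gcongr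
      linarith [(hγ2 j).2]
    · have : t * (ℓ - δ) ≤ ((j : ℝ) + 1) * (ℓ - δ) := by gcongr
      linarith [(hγ2 j).1]
  simp only [ncard_latticeBox_translate x R a b (hγ _)] at h1
  rw [Finset.sum_const, Finset.card_univ, Fintype.card_fin, smul_eq_mul] at h1
  have hnδ : (n : ℝ) * δ ≤ n * (ℓ - δ) := by gcongr
  have h2 := hlow (x + diag m ρ) (R - 2 * ρ) (a + δ) (a + δ + n * (ℓ - δ)) (by linarith)
    (by linarith)
  rw [← hJ] at h2
  have h1' : (J.ncard : ℝ) ≤ n * ((Γ : Set (Phys m × ℝ)) ∩ latticeBox x R a b).ncard := by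
    exact_mod_cast h1
  have h3 : n * (ℓ - κ) ≤ a + δ + n * (ℓ - δ) - (a + δ) - 2 * d := by
    rw [hκδ]; linarith
  have h4 : (R - (2 * ρ + 2 * d)) ^ m * (n * (ℓ - κ)) ≤
      (R - 2 * ρ - 2 * d) ^ m * (a + δ + n * (ℓ - δ) - (a + δ) - 2 * d) := by
    rw [← sub_sub]
    have : 0 ≤ R - 2 * ρ - 2 * d := by linarith
    gcongr
  rw [← mul_div_assoc, div_le_iff₀ hV]
  refine le_of_mul_le_mul_left ?_ hn0
  calc (n : ℝ) * ((R - (2 * ρ + 2 * d)) ^ m * (ℓ - κ))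
      = (R - (2 * ρ + 2 * d)) ^ m * (n * (ℓ - κ)) := by ring
    _ ≤ ZLattice.covolume Γ * J.ncard := h4.trans h2
    _ ≤ ZLattice.covolume Γ * (n * ((Γ : Set (Phys m × ℝ)) ∩ latticeBox x R a b).ncard) := by gcongr
    _ = _ := by ring

theorem tendsto_add_pow_div_pow (m : ℕ) (c : ℝ) :
    Tendsto (fun R : ℝ => (R + c) ^ m / R ^ m) atTop (𝓝 1) := by
  have h1 : Tendsto (fun R : ℝ => 1 + c * R⁻¹) atTop (𝓝 (1 + c * 0)) :=
    (tendsto_inv_atTop_zero.const_mul c).const_add 1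
  have h2 := h1.pow m
  rw [mul_zero, add_zero, one_pow] at h2
  refine h2.congr' ?_
  filter_upwards [eventually_gt_atTop 0] with R hR
  rw [← div_pow]
  congr 1
  field_simp

/-- The density of a model set is the length of its window divided by the covolume. -/
theorem hasDensity_modelSet (hinj : Set.InjOn Prod.fst (Γ : Set (Phys m × ℝ)))
    (hΓ : Dense (Prod.snd '' (Γ : Set (Phys m × ℝ)))) {r : ℝ} (hr : 0 < r) :
    HasDensity (modelSet Γ (Set.Icc (-r) r)) (2 * r / ZLattice.covolume Γ) := by
  intro x
  have hV : 0 < ZLattice.covolume Γ := ZLattice.covolume_pos Γ volume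
  have hcount : ∀ R, (modelSet Γ (Set.Icc (-r) r) ∩ cube x R).ncard =
      ((Γ : Set (Phys m × ℝ)) ∩ latticeBox x R (-r) r).ncard := by
    intro R
    rw [← (hinj.mono Set.inter_subset_left).ncard_image]
    congr 1
    ext y
    constructor
    · rintro ⟨⟨γ, hγ, h1, rfl⟩, h2⟩
      exact ⟨γ, ⟨hγ, h2, h1⟩, rfl⟩
    · rintro ⟨γ, ⟨hγ, h2, h1⟩, rfl⟩
      exact ⟨⟨γ, hγ, h1, rfl⟩, h2⟩
  simp only [hcount]
  rw [tendsto_order]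
  constructor
  · intro D' hD'
    -- leave room for a loss of `κ` in the length of the window
    obtain ⟨κ, hκ0, hκ1, hκ2⟩ : ∃ κ, 0 < κ ∧ κ < 2 * r ∧
        D' < (2 * r - κ) / ZLattice.covolume Γ := by
      rw [lt_div_iff₀ hV] at hD'
      refine ⟨min r ((2 * r - D' * ZLattice.covolume Γ) / 2), ?_, ?_, ?_⟩
      · exact lt_min hr (by linarith)
      · exact (min_le_left _ _).trans_lt (by linarith)
      · rw [lt_div_iff₀ hV]
        have := min_le_right r ((2 * r - D' * ZLattice.covolume Γ) / 2)
        linarith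
    obtain ⟨c, hc0, hc⟩ := exists_le_count (Γ := Γ) hΓ (a := -r) (b := r) hκ0 (by linarith)
    have ht := (tendsto_add_pow_div_pow m (-c)).mul_const ((2 * r - κ) / ZLattice.covolume Γ)
    rw [one_mul] at ht
    filter_upwards [ht.eventually (lt_mem_nhds hκ2), eventually_gt_atTop 0,
      eventually_ge_atTop c] with R h1 h2 h3
    refine h1.trans_le ?_
    rw [le_div_iff₀ (by positivity)]
    refine le_trans (le_of_eq ?_) (hc x R h3)
    rw [← sub_eq_add_neg, show r - -r = 2 * r by ring]
    field_simp
  · intro D' hD'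
    obtain ⟨κ, hκ0, hκ2⟩ : ∃ κ, 0 < κ ∧ (2 * r + κ) / ZLattice.covolume Γ < D' := by
      rw [gt_iff_lt, div_lt_iff₀ hV] at hD'
      refine ⟨(D' * ZLattice.covolume Γ - 2 * r) / 2, by linarith, ?_⟩
      rw [div_lt_iff₀ hV]; linarith
    obtain ⟨c, hc0, hc⟩ := exists_count_le (Γ := Γ) hΓ (a := -r) (b := r) (by linarith) hκ0
    have ht := (tendsto_add_pow_div_pow m c).mul_const ((2 * r + κ) / ZLattice.covolume Γ)
    rw [one_mul] at ht
    filter_upwards [ht.eventually (gt_mem_nhds hκ2), eventually_gt_atTop 0] with R h1 h2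
    refine lt_of_le_of_lt ?_ h1
    rw [div_le_iff₀ (by positivity)]
    refine (hc x R h2.le).trans (le_of_eq ?_)
    rw [show r - -r = 2 * r by ring]
    field_simp

end Density

/-! ### Wiener amalgam spaces -/

section Wiener

variable {m : ℕ}

theorem lintegral_le_tsum_cube (w : Phys m → ℝ≥0∞) :
    ∫⁻ x, w x ≤ ∑' k : Fin m → ℤ, ∫⁻ x in cube (WithLp.toLp 2 fun i => (k i : ℝ)) 1, w x := by
  have hcov : (⋃ k : Fin m → ℤ, cube (WithLp.toLp 2 fun i => (k i : ℝ)) 1)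
      = (Set.univ : Set (Phys m)) := by
    refine Set.eq_univ_of_forall fun x => Set.mem_iUnion.2 ⟨fun i => ⌊x i⌋, fun i => ?_⟩
    exact ⟨Int.floor_le _, (Int.lt_floor_add_one _).le⟩
  rw [← setLIntegral_univ, ← hcov]
  exact lintegral_iUnion_le _ _

theorem lintegral_enorm_sq_eq {α : Type*} [MeasurableSpace α] {μ : Measure α} (F : α → ℂ) :
    ∫⁻ t, ‖F t‖ₑ ^ 2 ∂μ = eLpNorm F 2 μ ^ 2 := by
  have := eLpNorm_nnreal_pow_eq_lintegral (f := F) (μ := μ) (p := 2) two_ne_zero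
  simp only [NNReal.coe_ofNat, ENNReal.rpow_ofNat, ENNReal.coe_ofNat] at this
  exact this.symm

theorem memLp_two_iff_lintegral {α : Type*} [MeasurableSpace α] {μ : Measure α} {F : α → ℂ}
    (hF : AEStronglyMeasurable F μ) : MemLp F 2 μ ↔ ∫⁻ t, ‖F t‖ₑ ^ 2 ∂μ < ∞ := by
  rw [lintegral_enorm_sq_eq, ENNReal.pow_lt_top_iff]
  simp [MemLp, hF]

theorem MemWienerAmalgam.memLp_two {f : Phys m → ℂ} (hf : MemWienerAmalgam f 2) : MemLp f 2 := by
  rw [memLp_two_iff_lintegral hf.1]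
  set S := ∑' k : Fin m → ℤ,
    eLpNorm ((cube (WithLp.toLp 2 fun i => (k i : ℝ)) 1).indicator f) 2 volume with hS
  calc ∫⁻ t, ‖f t‖ₑ ^ 2
      ≤ ∑' k : Fin m → ℤ, ∫⁻ x in cube (WithLp.toLp 2 fun i => (k i : ℝ)) 1, ‖f x‖ₑ ^ 2 :=
        lintegral_le_tsum_cube _
    _ ≤ ∑' k : Fin m → ℤ, S *
          eLpNorm ((cube (WithLp.toLp 2 fun i => (k i : ℝ)) 1).indicator f) 2 volume := by
        refine ENNReal.tsum_le_tsum fun k => ?_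
        rw [lintegral_enorm_sq_eq, eLpNorm_indicator_eq_eLpNorm_restrict (measurableSet_cube _ _),
          sq]
        gcongr
        rw [← eLpNorm_indicator_eq_eLpNorm_restrict (measurableSet_cube _ _)]
        exact ENNReal.le_tsum k
    _ = S * S := ENNReal.tsum_mul_left
    _ < ∞ := ENNReal.mul_lt_top hf.2 hf.2

theorem MemWienerAmalgam.integrable {f : Phys m → ℂ} (hf : MemWienerAmalgam f 2) :
    Integrable f := by
  refine ⟨hf.1, ?_⟩
  calc ∫⁻ t, ‖f t‖ₑ
      ≤ ∑' k : Fin m → ℤ, ∫⁻ x in cube (WithLp.toLp 2 fun i => (k i : ℝ)) 1, ‖f x‖ₑ :=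
        lintegral_le_tsum_cube _
    _ ≤ ∑' k : Fin m → ℤ,
          eLpNorm ((cube (WithLp.toLp 2 fun i => (k i : ℝ)) 1).indicator f) 2 volume := by
        refine ENNReal.tsum_le_tsum fun k => ?_
        rw [eLpNorm_indicator_eq_eLpNorm_restrict (measurableSet_cube _ _),
          ← eLpNorm_one_eq_lintegral_enorm]
        refine (eLpNorm_le_eLpNorm_mul_rpow_measure_univ (by norm_num : (1 : ℝ≥0∞) ≤ 2)
          hf.1.restrict).trans_eq ?_
        rw [Measure.restrict_apply_univ, volume_cube _ zero_le_one]
        simp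
    _ < ∞ := hf.2

end Wiener

/-! ### Correlations with translates -/

section Correlation

variable {m : ℕ}

/-- The Fourier transform of a square integrable function, as an element of `L²`. -/
noncomputable def ltwoFourier {f : Phys m → ℂ} (hf : MemLp f 2) : Phys m → ℂ :=
  ((𝓕 (hf.toLp f) : Lp ℂ 2 (volume : Measure (Phys m))) : Phys m → ℂ)

theorem memLp_ltwoFourier {f : Phys m → ℂ} (hf : MemLp f 2) : MemLp (ltwoFourier hf) 2 :=
  Lp.memLp _

theorem eLpNorm_ltwoFourier {f : Phys m → ℂ} (hf : MemLp f 2) :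
    eLpNorm (ltwoFourier hf) 2 volume = eLpNorm f 2 volume := by
  have h := Lp.norm_fourier_eq (hf.toLp f)
  rw [Lp.norm_def, Lp.norm_def,
    ENNReal.toReal_eq_toReal_iff' (Lp.eLpNorm_ne_top _) (Lp.eLpNorm_ne_top _)] at h
  exact h.trans (eLpNorm_congr_ae hf.coeFn_toLp)

/-- Every square integrable function is, up to a null set, a Fourier transform. -/
theorem exists_ltwoFourier_ae_eq {F : Phys m → ℂ} (hF : MemLp F 2) :
    ∃ (f : Phys m → ℂ) (hf : MemLp f 2), ltwoFourier hf =ᵐ[volume] F := by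
  set φ : Lp ℂ 2 (volume : Measure (Phys m)) := 𝓕⁻ (hF.toLp F) with hφ
  refine ⟨φ, Lp.memLp φ, ?_⟩
  have h1 : (Lp.memLp φ).toLp φ = φ := Lp.toLp_coeFn φ _
  have h2 : 𝓕 φ = hF.toLp F := FourierTransform.fourier_fourierInv_eq _
  unfold ltwoFourier
  rw [h1, h2]
  exact hF.coeFn_toLp

/-- The correlation `x ↦ ⟨f, T_x g⟩`. -/
noncomputable def corr (f g : Phys m → ℂ) (x : Phys m) : ℂ := l2Inner f (translateBy x g)

theorem l2Inner_conj (f g : Phys m → ℂ) : l2Inner g f = conj (l2Inner f g) := by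
  unfold l2Inner
  rw [← integral_conj]
  refine integral_congr_ae (Eventually.of_forall fun t => ?_)
  simp [mul_comm]

theorem corr_translate (f g : Phys m → ℂ) (x y : Phys m) :
    corr (fun t => f (t + x)) g y = corr f g (y + x) := by
  unfold corr l2Inner translateBy
  rw [← integral_add_right_eq_self (fun t => f t * conj (g (t - (y + x)))) x]
  refine integral_congr_ae (Eventually.of_forall fun t => ?_)
  simp only
  rw [show t + x - (y + x) = t - y by abel]

theorem memLp_comp_add_right {f : Phys m → ℂ} (hf : MemLp f 2) (x : Phys m) :
    MemLp (fun t => f (t + x)) 2 :=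
  hf.comp_measurePreserving (measurePreserving_add_right volume x)

theorem eLpNorm_comp_add_right {f : Phys m → ℂ} (hf : MemLp f 2) (x : Phys m) :
    eLpNorm (fun t => f (t + x)) 2 volume = eLpNorm f 2 volume :=
  eLpNorm_comp_measurePreserving hf.1 (measurePreserving_add_right volume x)

theorem integrable_ltwo_mul_conj {f g : Phys m → ℂ} (hf : MemLp f 2) (hg : MemLp g 2) :
    Integrable fun t => f t * conj (g t) := by
  have hg' : MemLp (fun t => conj (g t)) 2 := hg.star
  exact hf.integrable_mul hg'

theorem corr_sub {f f' g : Phys m → ℂ} (hf : MemLp f 2) (hf' : MemLp f' 2) (hg : MemLp g 2)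
    (x : Phys m) : corr (fun t => f t - f' t) g x = corr f g x - corr f' g x := by
  have hgx : MemLp (fun t => g (t - x)) 2 :=
    hg.comp_measurePreserving (measurePreserving_sub_right volume x)
  unfold corr l2Inner translateBy
  simp only [sub_mul]
  exact integral_sub (integrable_ltwo_mul_conj hf hgx) (integrable_ltwo_mul_conj hf' hgx)

/-- The product `f̂ · conj ĝ`, whose inverse Fourier integral is the correlation of `f` and `g`. -/
noncomputable def spec {f : Phys m → ℂ} (hf : MemLp f 2) (g : Phys m → ℂ) (t : Phys m) : ℂ :=
  ltwoFourier hf t * conj (𝓕 g t)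

theorem corr_eq_fourierInv {f g : Phys m → ℂ} (hf : MemLp f 2) (h1 : Integrable g)
    (h2 : MemLp g 2) : corr f g = 𝓕⁻ (spec hf g) := by
  ext x
  exact integral_mul_conj_translate hf h1 h2 x

theorem integrable_spec {f g : Phys m → ℂ} (hf : MemLp f 2) (h1 : Integrable g)
    (h2 : MemLp g 2) : Integrable (spec hf g) :=
  integrable_ltwo_mul_conj (memLp_ltwoFourier hf) (memLp_two_fourier h1 h2)

theorem memLp_spec {f g : Phys m → ℂ} (hf : MemLp f 2) (h1 : Integrable g) :
    MemLp (spec hf g) 2 := by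
  have hc := continuous_fourier_of_integrable h1
  refine MemLp.of_le_mul (c := ∫ v, ‖g v‖) (memLp_ltwoFourier hf)
    ((memLp_ltwoFourier hf).1.mul (Complex.continuous_conj.comp hc).aestronglyMeasurable)
    (Eventually.of_forall fun t => ?_)
  rw [spec, norm_mul, RCLike.norm_conj, mul_comm]
  gcongr
  exact norm_fourier_le_integral t

theorem continuous_corr {f g : Phys m → ℂ} (hf : MemLp f 2) (h1 : Integrable g)
    (h2 : MemLp g 2) : Continuous (corr f g) := by
  rw [corr_eq_fourierInv hf h1 h2]
  have h := (continuous_fourier_of_integrable (integrable_spec hf h1 h2)).comp continuous_neg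
  have e : 𝓕⁻ (spec hf g) = 𝓕 (spec hf g) ∘ fun a => -a :=
    funext fun x => Real.fourierInv_eq_fourier_neg (spec hf g) x
  rw [e]
  exact h

theorem integral_mul_conj_self {F : Phys m → ℂ} (hF : MemLp F 2) :
    ∫ t, F t * conj (F t) = (((eLpNorm F 2 volume).toReal ^ 2 : ℝ) : ℂ) := by
  have e : ∫ x, F x * conj (F x) = ((∫ x, ‖F x‖ ^ 2 : ℝ) : ℂ) := by
    rw [← integral_complex_ofReal]
    refine integral_congr_ae (Eventually.of_forall fun x => ?_)
    simp only
    rw [Complex.mul_conj, Complex.normSq_eq_norm_sq]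
  rw [e, integral_eq_lintegral_of_nonneg_ae (Eventually.of_forall fun x => by positivity)
    (hF.integrable_norm_pow two_ne_zero).1, ← ENNReal.toReal_pow, ← lintegral_enorm_sq_eq]
  congr 2
  refine lintegral_congr fun x => ?_
  rw [ENNReal.ofReal_pow (norm_nonneg _), ofReal_norm]

theorem lintegral_enorm_sq_fourierInv {F : Phys m → ℂ} (h1 : Integrable F) (h2 : MemLp F 2) :
    ∫⁻ x, ‖𝓕⁻ F x‖ₑ ^ 2 = ∫⁻ t, ‖F t‖ₑ ^ 2 := by
  have h3 := memLp_two_fourierInv h1 h2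
  have h4 := integral_fourierInv_mul_conj h1 h2 h1 h2
  rw [integral_mul_conj_self h3, integral_mul_conj_self h2, Complex.ofReal_inj,
    sq_eq_sq₀ ENNReal.toReal_nonneg ENNReal.toReal_nonneg,
    ENNReal.toReal_eq_toReal_iff' h3.2.ne h2.2.ne] at h4
  rw [lintegral_enorm_sq_eq, lintegral_enorm_sq_eq, h4]

/-- The Fourier transform of `⟨f, T_x g⟩ · conj ⟨f, T_x h⟩` at one frequency. -/
theorem integral_corr_mul_conj_corr {f g h : Phys m → ℂ} (hf : MemLp f 2) (hg1 : Integrable g)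
    (hg2 : MemLp g 2) (hh1 : Integrable h) (hh2 : MemLp h 2) (ξ : Phys m) :
    𝓕 (fun x => corr f g x * conj (corr f h x)) ξ
      = ∫ t, spec hf g t * conj (spec hf h (t - ξ)) := by
  have h1 := (integrable_spec hf hh1 hh2).comp_sub_right ξ
  have h2 : MemLp (fun t => spec hf h (t - ξ)) 2 :=
    (memLp_spec hf hh1).comp_measurePreserving (measurePreserving_sub_right volume ξ)
  rw [← integral_fourierInv_mul_conj (integrable_spec hf hg1 hg2) (memLp_spec hf hg1) h1 h2,
    Real.fourier_eq']
  refine integral_congr_ae (Eventually.of_forall fun x => ?_)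
  simp only
  rw [fourierInv_comp_sub_right, ← corr_eq_fourierInv hf hg1 hg2, ← corr_eq_fourierInv hf hh1 hh2,
    map_mul, ← Complex.exp_conj, map_mul, Complex.conj_I, Complex.conj_ofReal, smul_eq_mul]
  rw [show ((2 * Real.pi * ⟪x, ξ⟫_ℝ : ℝ) : ℂ) * -Complex.I
    = ((-2 * Real.pi * ⟪x, ξ⟫_ℝ : ℝ) : ℂ) * Complex.I by push_cast; ring]
  ring

end Correlation

/-! ### Sums over the model set -/

section ModelSetSums

variable {m : ℕ} {Γ : Submodule ℤ (Phys m × ℝ)}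

/-- The points of the model set are parametrized by the lattice points in the strip. -/
noncomputable def stripEquivModelSet (hinj : Set.InjOn Prod.fst (Γ : Set (Phys m × ℝ)))
    (Ω : Set ℝ) : {γ : Γ | (γ : Phys m × ℝ).2 ∈ Ω} ≃ modelSet Γ Ω :=
  Equiv.ofBijective (fun γ => ⟨(γ.1 : Phys m × ℝ).1, γ.1, γ.1.2, γ.2, rfl⟩) <| by
    constructor
    · intro γ γ' e
      exact Subtype.ext (Subtype.ext (hinj γ.1.2 γ'.1.2 (congrArg Subtype.val e)))
    · rintro ⟨a, γ, hγ, h2, rfl⟩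
      exact ⟨⟨⟨γ, hγ⟩, h2⟩, rfl⟩

theorem tsum_modelSet {E : Type*} [AddCommMonoid E] [TopologicalSpace E]
    (hinj : Set.InjOn Prod.fst (Γ : Set (Phys m × ℝ))) (Ω : Set ℝ) (F : Phys m → E) :
    ∑' a : modelSet Γ Ω, F a
      = ∑' γ : Γ, Ω.indicator (fun _ => F (γ : Phys m × ℝ).1) (γ : Phys m × ℝ).2 := by
  rw [← (stripEquivModelSet hinj Ω).tsum_eq]
  have := tsum_subtype {γ : Γ | (γ : Phys m × ℝ).2 ∈ Ω} fun γ => F (γ : Phys m × ℝ).1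
  refine this.trans (tsum_congr fun γ => ?_)
  by_cases hγ : (γ : Phys m × ℝ).2 ∈ Ω
  · rw [Set.indicator_of_mem hγ, Set.indicator_of_mem (by exact hγ)]
  · rw [Set.indicator_of_notMem hγ, Set.indicator_of_notMem (by exact hγ)]

end ModelSetSums

/-! ### Bessel systems -/

section Bessel

variable {m : ℕ} {Γ : Submodule ℤ (Phys m × ℝ)} {K : Type*} {g h : K → Phys m → ℂ}

/-- The square sum `∑ₖ |⟨f, T_x g_k⟩|²`. -/
noncomputable def corrSq (f : Phys m → ℂ) (g : K → Phys m → ℂ) (x : Phys m) : ℝ≥0∞ :=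
  ∑' k, ‖corr f (g k) x‖ₑ ^ 2

/-- The sum `∑ₖ ⟨f, T_x g_k⟩ conj ⟨f, T_x h_k⟩`, whose periodization along the strip gives the
frame sum of all translates of `f`. -/
noncomputable def corrProd (f : Phys m → ℂ) (g h : K → Phys m → ℂ) (x : Phys m) : ℂ :=
  ∑' k, corr f (g k) x * conj (corr f (h k) x)

theorem measurable_corrSq [Countable K] {f : Phys m → ℂ} (hf : MemLp f 2)
    (hg : ∀ k, MemWienerAmalgam (g k) 2) : Measurable (corrSq f g) :=
  Measurable.tsum fun k =>
    ((continuous_corr hf (hg k).integrable (hg k).memLp_two).measurable.enorm).pow_const 2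

theorem measurable_corrProd [Countable K] {f : Phys m → ℂ} (hf : MemLp f 2)
    (hg : ∀ k, MemWienerAmalgam (g k) 2) (hh : ∀ k, MemWienerAmalgam (h k) 2) :
    Measurable (corrProd f g h) :=
  Measurable.tsum fun k =>
    ((continuous_corr hf (hg k).integrable (hg k).memLp_two).mul (Complex.continuous_conj.comp
      (continuous_corr hf (hh k).integrable (hh k).memLp_two))).measurable

theorem ENNReal.mul_le_sq_add_sq (a b : ℝ≥0∞) : a * b ≤ a ^ 2 + b ^ 2 := by
  rcases le_total a b with hab | hab
  · calc a * b ≤ b * b := by gcongr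
      _ = b ^ 2 := (sq b).symm
      _ ≤ _ := le_add_self
  · calc a * b ≤ a * a := by gcongr
      _ = a ^ 2 := (sq a).symm
      _ ≤ _ := le_self_add

theorem tsum_enorm_mul_conj_le (a b : K → ℂ) :
    ∑' k, ‖a k * conj (b k)‖ₑ ≤ ∑' k, ‖a k‖ₑ ^ 2 + ∑' k, ‖b k‖ₑ ^ 2 := by
  rw [← ENNReal.tsum_add]
  refine ENNReal.tsum_le_tsum fun k => ?_
  rw [enorm_mul, RCLike.enorm_conj]
  exact ENNReal.mul_le_sq_add_sq _ _

theorem enorm_corrProd_le (f : Phys m → ℂ) (g h : K → Phys m → ℂ) (x : Phys m) :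
    ‖corrProd f g h x‖ₑ ≤ corrSq f g x + corrSq f h x :=
  (enorm_tsum_le _).trans (tsum_enorm_mul_conj_le _ _)

/-- The Bessel inequality for the translates of `f`. -/
theorem IsBesselSystem.stripSum_corrSq_le (hinj : Set.InjOn Prod.fst (Γ : Set (Phys m × ℝ)))
    {Ω : Set ℝ} {B : ℝ} (hB : IsBesselSystem g (modelSet Γ Ω) B) {f : Phys m → ℂ}
    (hf : MemLp f 2) (x : Phys m) :
    stripSum Γ Ω (corrSq f g) x ≤ ENNReal.ofReal B * eLpNorm f 2 volume ^ 2 := by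
  have h1 := hB.2 _ (memLp_comp_add_right hf x)
  rw [eLpNorm_comp_add_right hf x, ENNReal.tsum_comm] at h1
  refine le_of_eq_of_le ?_ h1
  have h2 : ∀ a : modelSet Γ Ω, ∑' k, ‖l2Inner (fun t => f (t + x))
      (translateBy (a : Phys m) (g k))‖ₑ ^ 2 = corrSq f g (a + x) := fun a =>
    tsum_congr fun k => by rw [← corr_translate]; rfl
  rw [tsum_congr h2, tsum_modelSet hinj Ω fun a => corrSq f g (a + x)]
  rfl

theorem stripSum_enorm_corrProd_le (hinj : Set.InjOn Prod.fst (Γ : Set (Phys m × ℝ)))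
    {Ω : Set ℝ} {B B' : ℝ} (hB : IsBesselSystem g (modelSet Γ Ω) B)
    (hB' : IsBesselSystem h (modelSet Γ Ω) B') {f : Phys m → ℂ} (hf : MemLp f 2) (x : Phys m) :
    stripSum Γ Ω (fun x => ‖corrProd f g h x‖ₑ) x ≤
      ENNReal.ofReal B * eLpNorm f 2 volume ^ 2 + ENNReal.ofReal B' * eLpNorm f 2 volume ^ 2 := by
  refine le_trans ?_ (add_le_add (hB.stripSum_corrSq_le hinj hf x)
    (hB'.stripSum_corrSq_le hinj hf x))
  unfold stripSum
  rw [← ENNReal.tsum_add]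
  refine ENNReal.tsum_le_tsum fun γ => ?_
  by_cases hγ : (γ : Phys m × ℝ).2 ∈ Ω
  · simpa only [Set.indicator_of_mem hγ] using enorm_corrProd_le f g h _
  · simp only [Set.indicator_of_notMem hγ, add_zero, le_refl]

theorem ofReal_mul_eLpNorm_sq_lt_top {f : Phys m → ℂ} (hf : MemLp f 2) (B : ℝ) :
    ENNReal.ofReal B * eLpNorm f 2 volume ^ 2 < ∞ :=
  ENNReal.mul_lt_top ENNReal.ofReal_lt_top (ENNReal.pow_lt_top hf.2)

/-- The Bessel inequality for all translates of `f` makes the square sum integrable. -/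
theorem IsBesselSystem.lintegral_corrSq_lt_top [Countable K] [DiscreteTopology Γ] [IsZLattice ℝ Γ]
    (hΓ : IsCutAndProject Γ) {r : ℝ} (hr : 0 < r) {B : ℝ}
    (hB : IsBesselSystem g (modelSet Γ (Set.Icc (-r) r)) B)
    (hg : ∀ k, MemWienerAmalgam (g k) 2) {f : Phys m → ℂ} (hf : MemLp f 2) :
    ∫⁻ x, corrSq f g x < ∞ :=
  lintegral_lt_top_of_stripSum_le hΓ.dense_snd hr (measurable_corrSq hf hg)
    (ofReal_mul_eLpNorm_sq_lt_top hf B) (hB.stripSum_corrSq_le hΓ.injOn_fst hf)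

end Bessel

/-! ### The Fourier transform of the correlation product -/

section FourierCorr

variable {m : ℕ} {K : Type*} {g h : K → Phys m → ℂ}

/-- The mixed sum `∑ₖ conj ĝ_k(t) ĥ_k(t - ξ)`. -/
noncomputable def mixedSum (g h : K → Phys m → ℂ) (ξ t : Phys m) : ℂ :=
  ∑' k, conj (𝓕 (g k) t) * 𝓕 (h k) (t - ξ)

theorem tsum_spec_mul_conj_spec {f : Phys m → ℂ} (hf : MemLp f 2) (ξ t : Phys m) :
    ∑' k, spec hf (g k) t * conj (spec hf (h k) (t - ξ))
      = ltwoFourier hf t * conj (ltwoFourier hf (t - ξ)) * mixedSum g h ξ t := by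
  rw [mixedSum, ← tsum_mul_left]
  refine tsum_congr fun k => ?_
  simp only [spec, map_mul, Complex.conj_conj]
  ring

theorem measurable_spec {f g : Phys m → ℂ} (hf : MemLp f 2) (hg : Integrable g) :
    Measurable (spec hf g) :=
  (Lp.stronglyMeasurable _).measurable.mul
    (Complex.continuous_conj.comp (continuous_fourier_of_integrable hg)).measurable

variable [Countable K]

theorem tsum_lintegral_enorm_sq_spec {f : Phys m → ℂ} (hf : MemLp f 2)
    (hg : ∀ k, MemWienerAmalgam (g k) 2) :
    ∑' k, ∫⁻ t, ‖spec hf (g k) t‖ₑ ^ 2 = ∫⁻ x, corrSq f g x := by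
  unfold corrSq
  rw [lintegral_tsum fun k =>
    ((continuous_corr hf (hg k).integrable (hg k).memLp_two).measurable.enorm.pow_const 2).aemeasurable]
  refine tsum_congr fun k => ?_
  rw [corr_eq_fourierInv hf (hg k).integrable (hg k).memLp_two, lintegral_enorm_sq_fourierInv
    (integrable_spec hf (hg k).integrable (hg k).memLp_two) (memLp_spec hf (hg k).integrable)]

theorem tsum_lintegral_enorm_spec_mul_lt_top {f : Phys m → ℂ} (hf : MemLp f 2)
    (hg : ∀ k, MemWienerAmalgam (g k) 2) (hh : ∀ k, MemWienerAmalgam (h k) 2)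
    (hfg : ∫⁻ x, corrSq f g x < ∞) (hfh : ∫⁻ x, corrSq f h x < ∞) (ξ : Phys m) :
    ∑' k, ∫⁻ t, ‖spec hf (g k) t * conj (spec hf (h k) (t - ξ))‖ₑ < ∞ := by
  refine lt_of_le_of_lt ?_ (ENNReal.add_lt_top.2 ⟨hfg, hfh⟩)
  rw [← tsum_lintegral_enorm_sq_spec hf hg, ← tsum_lintegral_enorm_sq_spec hf hh,
    ← ENNReal.tsum_add]
  refine ENNReal.tsum_le_tsum fun k => ?_
  rw [← lintegral_sub_right_eq_self (fun t => ‖spec hf (h k) t‖ₑ ^ 2) ξ,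
    ← lintegral_add_left ((measurable_spec hf (hg k).integrable).enorm.pow_const 2)]
  refine lintegral_mono fun t => ?_
  rw [enorm_mul, RCLike.enorm_conj]
  exact ENNReal.mul_le_sq_add_sq _ _

theorem integrable_spectral_integrand {f : Phys m → ℂ} (hf : MemLp f 2)
    (hg : ∀ k, MemWienerAmalgam (g k) 2) (hh : ∀ k, MemWienerAmalgam (h k) 2)
    (hfg : ∫⁻ x, corrSq f g x < ∞) (hfh : ∫⁻ x, corrSq f h x < ∞) (ξ : Phys m) :
    Integrable fun t => ltwoFourier hf t * conj (ltwoFourier hf (t - ξ)) * mixedSum g h ξ t := by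
  have hm : ∀ k, Measurable fun t => spec hf (g k) t * conj (spec hf (h k) (t - ξ)) := fun k =>
    (measurable_spec hf (hg k).integrable).mul (Complex.continuous_conj.measurable.comp
      ((measurable_spec hf (hh k).integrable).comp (measurable_sub_const ξ)))
  simp only [← tsum_spec_mul_conj_spec]
  refine ⟨(Measurable.tsum hm).aestronglyMeasurable, ?_⟩
  refine lt_of_le_of_lt (lintegral_mono fun t => enorm_tsum_le _) ?_
  rw [lintegral_tsum fun k => (hm k).enorm.aemeasurable]
  exact tsum_lintegral_enorm_spec_mul_lt_top hf hg hh hfg hfh ξ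

/-- The Fourier transform of the correlation product is the quadratic form of the mixed sum
`mixedSum g h ξ` at `f̂`. -/
theorem fourier_corrProd {f : Phys m → ℂ} (hf : MemLp f 2)
    (hg : ∀ k, MemWienerAmalgam (g k) 2) (hh : ∀ k, MemWienerAmalgam (h k) 2)
    (hfg : ∫⁻ x, corrSq f g x < ∞) (hfh : ∫⁻ x, corrSq f h x < ∞) (ξ : Phys m) :
    𝓕 (corrProd f g h) ξ
      = ∫ t, ltwoFourier hf t * conj (ltwoFourier hf (t - ξ)) * mixedSum g h ξ t := by
  have hcg := fun k => continuous_corr hf (hg k).integrable (hg k).memLp_two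
  have hch := fun k => continuous_corr hf (hh k).integrable (hh k).memLp_two
  have hm : ∀ k, Measurable fun t => spec hf (g k) t * conj (spec hf (h k) (t - ξ)) := fun k =>
    (measurable_spec hf (hg k).integrable).mul (Complex.continuous_conj.measurable.comp
      ((measurable_spec hf (hh k).integrable).comp (measurable_sub_const ξ)))
  have hcont : Continuous fun x : Phys m =>
      Complex.exp (((-2 * Real.pi * ⟪x, ξ⟫_ℝ : ℝ) : ℂ) * Complex.I) := by fun_prop
  calc 𝓕 (corrProd f g h) ξ
      = ∫ x, ∑' k, Complex.exp (((-2 * Real.pi * ⟪x, ξ⟫_ℝ : ℝ) : ℂ) * Complex.I) •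
          (corr f (g k) x * conj (corr f (h k) x)) := by
        rw [Real.fourier_eq']
        refine integral_congr_ae (Eventually.of_forall fun x => ?_)
        simp only [smul_eq_mul, corrProd]
        rw [tsum_mul_left]
    _ = ∑' k, 𝓕 (fun x => corr f (g k) x * conj (corr f (h k) x)) ξ := by
        rw [integral_tsum]
        · simp only [Real.fourier_eq']
        · intro k
          exact (hcont.smul ((hcg k).mul (Complex.continuous_conj.comp (hch k)))).aestronglyMeasurable
        · refine (lt_of_le_of_lt ?_ (ENNReal.add_lt_top.2 ⟨hfg, hfh⟩)).ne
          rw [← lintegral_add_left (measurable_corrSq hf hg), ← lintegral_tsum]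
          · refine lintegral_mono fun x => ?_
            refine le_of_eq_of_le (tsum_congr fun k => ?_) (tsum_enorm_mul_conj_le
              (fun k => corr f (g k) x) (fun k => corr f (h k) x))
            rw [enorm_smul, ← ofReal_norm (Complex.exp _), Complex.norm_exp_ofReal_mul_I,
              ENNReal.ofReal_one, one_mul]
          · intro k
            exact (hcont.smul ((hcg k).mul
              (Complex.continuous_conj.comp (hch k)))).measurable.enorm.aemeasurable
    _ = ∑' k, ∫ t, spec hf (g k) t * conj (spec hf (h k) (t - ξ)) :=
        tsum_congr fun k => integral_corr_mul_conj_corr hf (hg k).integrable (hg k).memLp_two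
          (hh k).integrable (hh k).memLp_two ξ
    _ = ∫ t, ∑' k, spec hf (g k) t * conj (spec hf (h k) (t - ξ)) :=
        (integral_tsum (fun k => (hm k).aestronglyMeasurable)
          (tsum_lintegral_enorm_spec_mul_lt_top hf hg hh hfg hfh ξ).ne).symm
    _ = _ := by simp only [tsum_spec_mul_conj_spec]

end FourierCorr

/-! ### Polarization -/

section Polarization

variable {m : ℕ}

/-- A multiplier is determined by the quadratic form `F ↦ ∫ F(t) conj F(t - ξ) M(t)`: polarization
gives the sesquilinear form, which is then tested on indicator functions of a set and of its
translate. -/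
theorem ae_eq_zero_of_quadratic {M : Phys m → ℂ} {ξ : Phys m}
    (hi : ∀ F : Phys m → ℂ, MemLp F 2 → Integrable fun t => F t * conj (F (t - ξ)) * M t)
    (hz : ∀ F : Phys m → ℂ, MemLp F 2 → ∫ t, F t * conj (F (t - ξ)) * M t = 0) :
    M =ᵐ[volume] 0 := by
  have key : ∀ F G : Phys m → ℂ, MemLp F 2 → MemLp G 2 →
      (Integrable fun t => F t * conj (G (t - ξ)) * M t) ∧
        ∫ t, F t * conj (G (t - ξ)) * M t = 0 := by
    intro F G hF hG
    have hP : MemLp (fun t => F t + G t) 2 := hF.add hG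
    have hQ : MemLp (fun t => F t + Complex.I * G t) 2 := hF.add (hG.const_mul Complex.I)
    set q : (Phys m → ℂ) → Phys m → ℂ := fun F t => F t * conj (F (t - ξ)) * M t with hq
    -- polarization with `F + G` and `F + i G`
    have e : (fun t => F t * conj (G (t - ξ)) * M t) = fun t => (1 / 2 : ℂ) *
        (((q (fun t => F t + G t) t - q F t) - q G t)
          + Complex.I * ((q (fun t => F t + Complex.I * G t) t - q F t) - q G t)) := by
      ext t
      simp only [hq, map_add, map_mul, Complex.conj_I]
      ring_nf
      simp only [Complex.I_sq, show Complex.I ^ 3 = -Complex.I by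
        rw [pow_succ, Complex.I_sq]; ring]
      ring
    have i1 : Integrable (q fun t => F t + G t) := hi _ hP
    have i2 : Integrable (q fun t => F t + Complex.I * G t) := hi _ hQ
    have i3 : Integrable (q F) := hi _ hF
    have i4 : Integrable (q G) := hi _ hG
    have z1 : ∫ t, q (fun t => F t + G t) t = 0 := hz _ hP
    have z2 : ∫ t, q (fun t => F t + Complex.I * G t) t = 0 := hz _ hQ
    have z3 : ∫ t, q F t = 0 := hz _ hF
    have z4 : ∫ t, q G t = 0 := hz _ hG
    have lin : ∀ a : Phys m → ℂ, Integrable a → ∫ t, a t = 0 →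
        Integrable (fun t => a t - q F t - q G t) ∧ ∫ t, (a t - q F t - q G t) = 0 := by
      intro a ia za
      have i5 : Integrable fun t => a t - q F t := ia.sub i3
      refine ⟨i5.sub i4, ?_⟩
      rw [integral_sub i5 i4, integral_sub ia i3, za, z3, z4]
      simp
    obtain ⟨j1, y1⟩ := lin _ i1 z1
    obtain ⟨j2, y2⟩ := lin _ i2 z2
    rw [e]
    refine ⟨(j1.add (j2.const_mul _)).const_mul _, ?_⟩
    rw [integral_const_mul, integral_add j1 (j2.const_mul _), integral_const_mul, y1, y2]
    simp
  have hset : ∀ A : Set (Phys m), MeasurableSet A → volume A < ∞ →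
      IntegrableOn M A ∧ ∫ t in A, M t = 0 := by
    intro A hA hAf
    have hF : MemLp (A.indicator fun _ => (1 : ℂ)) 2 :=
      memLp_indicator_const 2 hA 1 (Or.inr hAf.ne)
    -- the second indicator is translated so that both factors are supported on `A`
    have hG := memLp_comp_add_right hF ξ
    have e : (fun t => A.indicator (fun _ => (1 : ℂ)) t *
        conj ((fun t => A.indicator (fun _ => (1 : ℂ)) (t + ξ)) (t - ξ)) * M t)
        = A.indicator M := by
      ext t
      simp only [sub_add_cancel]
      by_cases ht : t ∈ A <;> simp [ht]
    have := key _ _ hF hG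
    rw [e, integrable_indicator_iff hA, integral_indicator hA] at this
    exact this
  exact ae_eq_zero_of_forall_setIntegral_eq_of_sigmaFinite (fun A hA hf => (hset A hA hf).1)
    (fun A hA hf => (hset A hA hf).2)

end Polarization

/-! ### Continuity of the frame sum -/

section Analysis

variable {m : ℕ} {Γ : Submodule ℤ (Phys m × ℝ)} {Ω : Set ℝ} {K : Type*} {g h : K → Phys m → ℂ}
  {B B' : ℝ}

theorem corr_congr_ae {f f' : Phys m → ℂ} (h : f =ᵐ[volume] f') (g : Phys m → ℂ) (x : Phys m) :
    corr f g x = corr f' g x := by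
  refine integral_congr_ae ?_
  filter_upwards [h] with t ht
  rw [ht]

theorem IsBesselSystem.tsum_prod_le (hB : IsBesselSystem g (modelSet Γ Ω) B) {f : Phys m → ℂ}
    (hf : MemLp f 2) : ∑' p : K × modelSet Γ Ω, ‖corr f (g p.1) p.2‖ₑ ^ 2
      ≤ ENNReal.ofReal B * eLpNorm f 2 volume ^ 2 := by
  rw [ENNReal.tsum_prod']
  exact hB.2 f hf

theorem IsBesselSystem.memℓp (hB : IsBesselSystem g (modelSet Γ Ω) B) {f : Phys m → ℂ}
    (hf : MemLp f 2) :
    Memℓp (fun p : K × modelSet Γ Ω => corr f (g p.1) p.2) 2 := by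
  refine memℓp_gen ?_
  have := ENNReal.summable_toReal
    ((hB.tsum_prod_le hf).trans_lt (ofReal_mul_eLpNorm_sq_lt_top hf B)).ne
  simpa using this

/-- The analysis operator `f ↦ (⟨f, T_λ g_k⟩)_{k, λ}` of a Bessel system, from `L²` to `ℓ²`. -/
noncomputable def IsBesselSystem.analysis (hB : IsBesselSystem g (modelSet Γ Ω) B)
    (φ : Lp ℂ 2 (volume : Measure (Phys m))) : lp (fun _ : K × modelSet Γ Ω => ℂ) 2 :=
  ⟨fun p => corr φ (g p.1) p.2, hB.memℓp (Lp.memLp φ)⟩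

theorem IsBesselSystem.norm_analysis_le (hB : IsBesselSystem g (modelSet Γ Ω) B)
    (φ : Lp ℂ 2 (volume : Measure (Phys m))) : ‖hB.analysis φ‖ ≤ √B * ‖φ‖ := by
  have h2 : (0 : ℝ) < (2 : ℝ≥0∞).toReal := by norm_num
  refine lp.norm_le_of_tsum_le h2 (by positivity) ?_
  have h1 := hB.tsum_prod_le (Lp.memLp φ)
  have h3 := ENNReal.toReal_mono (ofReal_mul_eLpNorm_sq_lt_top (Lp.memLp φ) B).ne h1
  rw [ENNReal.tsum_toReal_eq fun _ => by simp, ENNReal.toReal_mul, ENNReal.toReal_ofReal hB.1.le,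
    ENNReal.toReal_pow, ← Lp.norm_def] at h3
  rw [ENNReal.toReal_ofNat, Real.rpow_ofNat, mul_pow, Real.sq_sqrt hB.1.le]
  refine le_of_eq_of_le (tsum_congr fun p => ?_) h3
  simp [IsBesselSystem.analysis]

theorem IsBesselSystem.analysis_sub (hB : IsBesselSystem g (modelSet Γ Ω) B)
    (hg : ∀ k, MemWienerAmalgam (g k) 2) (φ ψ : Lp ℂ 2 (volume : Measure (Phys m))) :
    hB.analysis (φ - ψ) = hB.analysis φ - hB.analysis ψ := by
  ext p
  have h1 := corr_congr_ae (Lp.coeFn_sub φ ψ) (g p.1) p.2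
  exact h1.trans (corr_sub (Lp.memLp φ) (Lp.memLp ψ) (hg p.1).memLp_two p.2)

theorem IsBesselSystem.continuous_analysis (hB : IsBesselSystem g (modelSet Γ Ω) B)
    (hg : ∀ k, MemWienerAmalgam (g k) 2) : Continuous hB.analysis := by
  refine (LipschitzWith.of_dist_le_mul (K := (√B).toNNReal) fun φ ψ => ?_).continuous
  rw [dist_eq_norm, dist_eq_norm, ← hB.analysis_sub hg, Real.coe_toNNReal _ (Real.sqrt_nonneg _)]
  exact hB.norm_analysis_le _

/-- The frame sum is the inner product of the two analysis coefficient sequences. -/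
theorem IsBesselSystem.hasSum_inner_analysis (hB : IsBesselSystem g (modelSet Γ Ω) B)
    (hB' : IsBesselSystem h (modelSet Γ Ω) B') {f : Phys m → ℂ} (hf : MemLp f 2) :
    HasSum (fun p : K × modelSet Γ Ω => corr f (g p.1) p.2 * conj (corr f (h p.1) p.2))
      ⟪hB'.analysis (hf.toLp f), hB.analysis (hf.toLp f)⟫_ℂ := by
  have h1 := lp.hasSum_inner (𝕜 := ℂ) (hB'.analysis (hf.toLp f)) (hB.analysis (hf.toLp f))
  refine h1.congr_fun fun p => ?_
  rw [← corr_congr_ae hf.coeFn_toLp (g p.1), ← corr_congr_ae hf.coeFn_toLp (h p.1)]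
  rfl

theorem IsBesselSystem.inner_analysis_eq (hB : IsBesselSystem g (modelSet Γ Ω) B)
    (hB' : IsBesselSystem h (modelSet Γ Ω) B')
    (hinj : Set.InjOn Prod.fst (Γ : Set (Phys m × ℝ))) {f : Phys m → ℂ} (hf : MemLp f 2) :
    ⟪hB'.analysis (hf.toLp f), hB.analysis (hf.toLp f)⟫_ℂ
      = ∑' γ : Γ, Ω.indicator (fun _ => corrProd f g h (γ : Phys m × ℝ).1)
          (γ : Phys m × ℝ).2 := by
  rw [← tsum_modelSet hinj Ω (corrProd f g h)]
  have h1 := (Equiv.prodComm (modelSet Γ Ω) K).hasSum_iff.2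
    (hB.hasSum_inner_analysis hB' hf)
  rw [← h1.tsum_eq, h1.summable.tsum_prod]
  rfl

end Analysis

section Continuity

variable {m : ℕ} {Γ : Submodule ℤ (Phys m × ℝ)} {r : ℝ} {K : Type*} {g h : K → Phys m → ℂ}
  {B B' : ℝ}

theorem corrProd_translate (f : Phys m → ℂ) (g h : K → Phys m → ℂ) (x y : Phys m) :
    corrProd (fun t => f (t + x)) g h y = corrProd f g h (y + x) :=
  tsum_congr fun k => by rw [corr_translate, corr_translate]

/-- The frame sum of the translate of `f` by `-x` is the value of the periodization at `(x, 0)`. -/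
theorem IsBesselSystem.inner_analysis_translate
    (hB : IsBesselSystem g (modelSet Γ (Set.Icc (-r) r)) B)
    (hB' : IsBesselSystem h (modelSet Γ (Set.Icc (-r) r)) B')
    (hinj : Set.InjOn Prod.fst (Γ : Set (Phys m × ℝ))) {f : Phys m → ℂ} (hf : MemLp f 2)
    (x : Phys m) :
    ⟪hB'.analysis ((memLp_comp_add_right hf x).toLp _),
      hB.analysis ((memLp_comp_add_right hf x).toLp _)⟫_ℂ
      = stripPeriodization Γ r (corrProd f g h) (x, 0) := by
  rw [hB.inner_analysis_eq hB' hinj]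
  simp only [corrProd_translate, stripPeriodization, add_zero]

/-- The frame sum of the translates of `f` depends continuously on the translation. -/
theorem IsBesselSystem.continuous_stripPeriodization
    (hB : IsBesselSystem g (modelSet Γ (Set.Icc (-r) r)) B)
    (hB' : IsBesselSystem h (modelSet Γ (Set.Icc (-r) r)) B')
    (hg : ∀ k, MemWienerAmalgam (g k) 2) (hh : ∀ k, MemWienerAmalgam (h k) 2)
    (hinj : Set.InjOn Prod.fst (Γ : Set (Phys m × ℝ))) {f : Phys m → ℂ} (hf : MemLp f 2) :
    Continuous fun x => stripPeriodization Γ r (corrProd f g h) (x, 0) := by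
  have hτ : Continuous fun x : Phys m => (memLp_comp_add_right hf x).toLp (fun t => f (t + x)) := by
    have hc : Continuous fun x : Phys m => (⟨fun t => t + x, by fun_prop⟩ : C(Phys m, Phys m)) :=
      ContinuousMap.continuous_of_continuous_uncurry _ (by
        change Continuous fun q : Phys m × Phys m => q.2 + q.1
        fun_prop)
    have := (continuous_const (y := hf.toLp f)).compMeasurePreservingLp hc
      (fun x => measurePreserving_add_right volume x) ENNReal.ofNat_ne_top
    refine this.congr fun x => ?_
    refine Lp.ext ?_
    refine (Lp.coeFn_compMeasurePreserving _ _).trans (EventuallyEq.trans ?_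
      (MemLp.coeFn_toLp _).symm)
    exact (measurePreserving_add_right volume x).quasiMeasurePreserving.ae_eq hf.coeFn_toLp
  refine (((hB'.continuous_analysis hh).comp hτ).inner
    ((hB.continuous_analysis hg).comp hτ) (𝕜 := ℂ)).congr fun x => ?_
  exact hB.inner_analysis_translate hB' hinj hf x

theorem IsBesselSystem.hasSum_stripPeriodization
    (hB : IsBesselSystem g (modelSet Γ (Set.Icc (-r) r)) B)
    (hB' : IsBesselSystem h (modelSet Γ (Set.Icc (-r) r)) B')
    (hinj : Set.InjOn Prod.fst (Γ : Set (Phys m × ℝ))) {f : Phys m → ℂ} (hf : MemLp f 2)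
    (x : Phys m) :
    HasSum (fun p : K × modelSet Γ (Set.Icc (-r) r) =>
      l2Inner (fun t => f (t + x)) (translateBy (p.2 : Phys m) (g p.1)) *
        l2Inner (translateBy (p.2 : Phys m) (h p.1)) (fun t => f (t + x)))
      (stripPeriodization Γ r (corrProd f g h) (x, 0)) := by
  rw [← hB.inner_analysis_translate hB' hinj hf x]
  refine (hB.hasSum_inner_analysis hB' (memLp_comp_add_right hf x)).congr_fun fun p => ?_
  rw [l2Inner_conj (fun t => f (t + x))]
  rfl

end Continuity

/-! ### The spectral identity -/

section Spectral

variable {m : ℕ}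

variable {Γ : Submodule ℤ (Phys m × ℝ)} {K : Type*} [Countable K] {g h : K → Phys m → ℂ}

/-- The quadratic form of the multiplier `s H_ξ - δ`, evaluated at `f̂`. -/
theorem integral_multiplier {f : Phys m → ℂ} (hf : MemLp f 2)
    (hg : ∀ k, MemWienerAmalgam (g k) 2) (hh : ∀ k, MemWienerAmalgam (h k) 2)
    (hfg : ∫⁻ x, corrSq f g x < ∞) (hfh : ∫⁻ x, corrSq f h x < ∞) (s : ℂ) (η : Phys m × ℝ) :
    (Integrable fun t => ltwoFourier hf t * conj (ltwoFourier hf (t - η.1)) *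
        (s * mixedSum g h η.1 t - if η = 0 then 1 else 0)) ∧
      ∫ t, ltwoFourier hf t * conj (ltwoFourier hf (t - η.1)) *
        (s * mixedSum g h η.1 t - if η = 0 then 1 else 0)
        = s * 𝓕 (corrProd f g h) η.1
          - if η = 0 then (((eLpNorm f 2 volume).toReal ^ 2 : ℝ) : ℂ) else 0 := by
  have i1 := (integrable_spectral_integrand hf hg hh hfg hfh η.1).const_mul s
  have i2 : Integrable fun t => ltwoFourier hf t * conj (ltwoFourier hf (t - η.1)) :=
    integrable_ltwo_mul_conj (memLp_ltwoFourier hf) ((memLp_ltwoFourier hf).comp_measurePreserving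
      (measurePreserving_sub_right volume η.1))
  have i3 := i2.mul_const (if η = 0 then 1 else 0)
  have e : (fun t => ltwoFourier hf t * conj (ltwoFourier hf (t - η.1)) *
        (s * mixedSum g h η.1 t - if η = 0 then 1 else 0)) = fun t =>
      s * (ltwoFourier hf t * conj (ltwoFourier hf (t - η.1)) * mixedSum g h η.1 t)
        - ltwoFourier hf t * conj (ltwoFourier hf (t - η.1)) * (if η = 0 then 1 else 0) := by
    ext t
    ring
  rw [e]
  refine ⟨i1.sub i3, ?_⟩
  rw [integral_sub i1 i3, integral_const_mul, fourier_corrProd hf hg hh hfg hfh,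
    integral_mul_const]
  by_cases hη : η = 0
  · subst hη
    simp only [Prod.fst_zero, sub_zero, if_true, mul_one]
    rw [integral_mul_conj_self (memLp_ltwoFourier hf), eLpNorm_ltwoFourier]
  · simp [hη]

/-- The quadratic forms of a multiplier `s H_ξ - δ` at all Fourier transforms determine it. -/
theorem ae_mul_mixedSum_eq_of_forall (hg : ∀ k, MemWienerAmalgam (g k) 2)
    (hh : ∀ k, MemWienerAmalgam (h k) 2)
    (hfg : ∀ f : Phys m → ℂ, MemLp f 2 → ∫⁻ x, corrSq f g x < ∞)
    (hfh : ∀ f : Phys m → ℂ, MemLp f 2 → ∫⁻ x, corrSq f h x < ∞) {s : ℂ} {η : Phys m × ℝ}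
    (hz : ∀ f : Phys m → ℂ, MemLp f 2 → s * 𝓕 (corrProd f g h) η.1
      = if η = 0 then (((eLpNorm f 2 volume).toReal ^ 2 : ℝ) : ℂ) else 0) :
    ∀ᵐ t : Phys m, s * mixedSum g h η.1 t = if η = 0 then 1 else 0 := by
  have hcongr : ∀ F : Phys m → ℂ, MemLp F 2 volume →
      ∃ (f : Phys m → ℂ) (hf : MemLp f 2 volume),
      ∀ M : Phys m → ℂ, (fun t : Phys m => ltwoFourier hf t * conj (ltwoFourier hf (t - η.1)) * M t)
        =ᵐ[volume] fun t : Phys m => F t * conj (F (t - η.1)) * M t := by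
    intro F hF
    obtain ⟨f, hf, hfF⟩ := exists_ltwoFourier_ae_eq hF
    refine ⟨f, hf, fun M => ?_⟩
    have h2 := (measurePreserving_sub_right (volume : Measure (Phys m))
      η.1).quasiMeasurePreserving.ae_eq hfF
    filter_upwards [hfF, h2] with t ht1 ht2
    simp only [Function.comp_apply] at ht2
    rw [ht1, ht2]
  have hM : (fun t => s * mixedSum g h η.1 t - if η = 0 then 1 else 0) =ᵐ[volume] 0 := by
    refine ae_eq_zero_of_quadratic (ξ := η.1) (fun F hF => ?_) (fun F hF => ?_)
    · obtain ⟨f, hf, he⟩ := hcongr F hF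
      exact (integral_multiplier hf hg hh (hfg f hf) (hfh f hf) s η).1.congr (he _)
    · obtain ⟨f, hf, he⟩ := hcongr F hF
      rw [← integral_congr_ae (he _), (integral_multiplier hf hg hh (hfg f hf) (hfh f hf) s η).2,
        hz f hf, sub_self]
  filter_upwards [hM] with t ht
  exact sub_eq_zero.1 ht

/-- Converse of `ae_mul_mixedSum_eq_of_forall`, for a single function. -/
theorem mul_fourier_corrProd_eq_of_ae {f : Phys m → ℂ} (hf : MemLp f 2)
    (hg : ∀ k, MemWienerAmalgam (g k) 2) (hh : ∀ k, MemWienerAmalgam (h k) 2)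
    (hfg : ∫⁻ x, corrSq f g x < ∞) (hfh : ∫⁻ x, corrSq f h x < ∞) {s : ℂ} {η : Phys m × ℝ}
    (H : ∀ᵐ t : Phys m, s * mixedSum g h η.1 t = if η = 0 then 1 else 0) :
    s * 𝓕 (corrProd f g h) η.1
      = if η = 0 then (((eLpNorm f 2 volume).toReal ^ 2 : ℝ) : ℂ) else 0 := by
  have h1 := (integral_multiplier hf hg hh hfg hfh s η).2
  rw [integral_eq_zero_of_ae, eq_comm, sub_eq_zero] at h1
  · exact h1
  · filter_upwards [H] with t ht
    rw [ht, sub_self, mul_zero]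
    rfl

variable [DiscreteTopology Γ] [IsZLattice ℝ Γ]

theorem two_mul_sinc_eq_covolume_mul (r x : ℝ) :
    ((2 * r * Real.sinc (Real.pi * (2 * r) * x) : ℝ) : ℂ) = (ZLattice.covolume Γ : ℂ) *
      ((2 * r / ZLattice.covolume Γ * Real.sinc (Real.pi * (2 * r) * x) : ℝ) : ℂ) := by
  have hcov := ZLattice.covolume_ne_zero Γ volume
  rw [← Complex.ofReal_mul]
  congr 1
  field_simp

/-- The frame sums of all translates of all functions reproduce the squared norm if and only if
the dual lattice conditions hold. -/
theorem forall_stripPeriodization_eq_iff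
    (hΓ : IsCutAndProject Γ) {r : ℝ} (hr : 0 < r) (hgen : ∀ γ ∈ Γ, γ.2 ≠ r ∧ γ.2 ≠ -r)
    (hg : ∀ k, MemWienerAmalgam (g k) 2) (hh : ∀ k, MemWienerAmalgam (h k) 2) {B B' : ℝ}
    (hB : IsBesselSystem g (modelSet Γ (Set.Icc (-r) r)) B)
    (hB' : IsBesselSystem h (modelSet Γ (Set.Icc (-r) r)) B') :
    (∀ f : Phys m → ℂ, MemLp f 2 → ∀ x, stripPeriodization Γ r (corrProd f g h) (x, 0)
        = (((eLpNorm f 2 volume).toReal ^ 2 : ℝ) : ℂ))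
      ↔ ∀ η ∈ dualLattice Γ, ∀ᵐ t : Phys m,
        ((2 * r / ZLattice.covolume Γ * Real.sinc (Real.pi * (2 * r) * η.2) : ℝ) : ℂ)
          * mixedSum g h η.1 t = if η = 0 then 1 else 0 := by
  have hcov : (ZLattice.covolume Γ : ℂ) ≠ 0 :=
    Complex.ofReal_ne_zero.2 (ZLattice.covolume_ne_zero Γ volume)
  have hfin : ∀ f : Phys m → ℂ, MemLp f 2 volume →
      ENNReal.ofReal B * eLpNorm f 2 volume ^ 2 + ENNReal.ofReal B' * eLpNorm f 2 volume ^ 2 < ∞ :=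
    fun f hf => ENNReal.add_lt_top.2
      ⟨ofReal_mul_eLpNorm_sq_lt_top hf B, ofReal_mul_eLpNorm_sq_lt_top hf B'⟩
  have hG := fun (f : Phys m → ℂ) (hf : MemLp f 2 volume) => hB.lintegral_corrSq_lt_top hΓ hr hg hf
  have hH := fun (f : Phys m → ℂ) (hf : MemLp f 2 volume) => hB'.lintegral_corrSq_lt_top hΓ hr hh hf
  constructor
  · intro H η hη
    refine ae_mul_mixedSum_eq_of_forall hg hh hG hH fun f hf => ?_
    have h1 := fourier_of_stripPeriodization_eq_const hΓ.dense_snd hr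
      (measurable_corrProd hf hg hh) (hfin f hf)
      (stripSum_enorm_corrProd_le hΓ.injOn_fst hB hB' hf) (H f hf) hη
    rw [two_mul_sinc_eq_covolume_mul (Γ := Γ), mul_assoc] at h1
    refine mul_left_cancel₀ hcov (h1.trans ?_)
    rw [mul_ite, mul_zero]
  · intro H f hf
    have hae := ae_stripPeriodization_eq_const_of_fourier hΓ.dense_snd hr hgen
      (measurable_corrProd hf hg hh) (hfin f hf)
      (stripSum_enorm_corrProd_le hΓ.injOn_fst hB hB' hf)
      (c := (((eLpNorm f 2 volume).toReal ^ 2 : ℝ) : ℂ)) (fun η hη => by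
        rw [two_mul_sinc_eq_covolume_mul (Γ := Γ), mul_assoc,
          mul_fourier_corrProd_eq_of_ae hf hg hh (hG f hf) (hH f hf) (H η hη), mul_ite, mul_zero])
    -- both sides are continuous, so the almost everywhere equality holds everywhere
    have hc := hB.continuous_stripPeriodization hB' hg hh hΓ.injOn_fst hf
    have := Measure.eq_of_ae_eq (μ := (volume : Measure (Phys m))) hae hc continuous_const
    exact fun x => congrFun this x

end Spectral

/-! ### Characterization of the reproducing identity -/

theorem theorem4p9 {m : ℕ} {K : Type*} [Countable K]
    (Γ : Submodule ℤ (Phys m × ℝ)) [DiscreteTopology Γ] [IsZLattice ℝ Γ]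
    (hΓ : IsCutAndProject Γ)
    (Ω : Set ℝ) (hΩ : IsSimpleWindow Ω) (hsymm : -Ω = Ω) (hgen : IsGeneric Γ Ω)
    (ε : ℝ) (hε0 : 0 < ε) (hε1 : ε < 1)
    (g h : K → Phys m → ℂ)
    (hg : ∀ k, MemWienerAmalgam (g k) 2) (hh : ∀ k, MemWienerAmalgam (h k) 2)
    (Bg Bh : ℝ)
    (hgB : IsBesselSystem g (modelSet Γ Ω) Bg) (hhB : IsBesselSystem h (modelSet Γ Ω) Bh) :
    ∃ (D : ℝ) (Ψ : ℝ → ℝ),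
      HasDensity (modelSet Γ Ω) D ∧
      TendstoUniformly (psiHat Ω ε) Ψ atTop ∧
      ((∀ f : Phys m → ℂ, MemLp f 2 volume →
          HasSum (fun p : K × modelSet Γ Ω =>
              l2Inner f (translateBy (p.2 : Phys m) (g p.1)) *
                l2Inner (translateBy (p.2 : Phys m) (h p.1)) f)
            (((eLpNorm f 2 volume).toReal ^ 2 : ℝ) : ℂ))
        ↔
        ∀ η ∈ dualLattice Γ, ∀ᵐ t : Phys m,
          ((D * windowPhi Ω Ψ (-η.2) : ℝ) : ℂ) *
              ∑' k : K, conj (𝓕 (g k) t) * 𝓕 (h k) (t - η.1)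
            = if η = 0 then 1 else 0) := by
  obtain ⟨r, hr, rfl⟩ := exists_eq_Icc_of_isSimpleWindow hΩ hsymm
  have hgen' : ∀ γ ∈ Γ, γ.2 ≠ r ∧ γ.2 ≠ -r := by
    intro γ hγ
    have h1 : γ.2 ∉ frontier (Set.Icc (-r) r) := fun h =>
      Set.disjoint_left.1 hgen h ⟨γ, hγ, rfl⟩
    rw [frontier_Icc (by linarith)] at h1
    constructor
    · rintro e
      exact h1 (by simp [e])
    · rintro e
      exact h1 (by simp [e])
  refine ⟨2 * r / ZLattice.covolume Γ, fun t => Real.sinc (Real.pi * (2 * r) * t),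
    hasDensity_modelSet hΓ.injOn_fst hΓ.dense_snd hr, tendstoUniformly_psiHat hr hε0 hε1, ?_⟩
  have h1 := forall_stripPeriodization_eq_iff hΓ hr hgen' hg hh hgB hhB
  simp only [windowPhi_Icc hr, mul_neg, Real.sinc_neg]
  refine Iff.trans ⟨fun H f hf x => ?_, fun H f hf => ?_⟩ h1
  · have h2 := hgB.hasSum_stripPeriodization hhB hΓ.injOn_fst hf x
    have h3 := H _ (memLp_comp_add_right hf x)
    rw [eLpNorm_comp_add_right hf x] at h3
    exact h2.unique h3
  · have h2 := hgB.hasSum_stripPeriodization hhB hΓ.injOn_fst hf 0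
    rw [H f hf 0] at h2
    simpa only [add_zero] using h2
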